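/- Let $p$ be a prime, let $K$ be a field of characteristic $p$, and let $R = K[[x,y,z,w]]/(xy,yz,zw)$, with maximal ideal $m$. Let $R^o$ be the complement of the union of the minimal primes of $R$. For an $R$-module $M$ put $F^e(M) = R^e\otimes_R M$, where $R^e$ is $R$ viewed as an $R$-algebra through the $e$-th iterate of Frobenius. For a submodule $N\subseteq M$, the tight closure $N^*_M$ is the set of all $u\in M$ for which there is $c\in R^o$ such that $c\otimes u$ lies in the image of $F^e(N)\to F^e(M)$ for all sufficiently large $e$; for an ideal $I$ write $I^*=I^*_R$. The test ideal $\tau(R)$ is $\bigcap_M \mathrm{Ann}_R(0^*_M)$ over all finitely generated $R$-modules $M$, and the parameter test ideal $\tau_{\rm par}(R)$ is $\bigcap_I (I : I^*)$ over all ideals $I$ generated by a system of parameters. Then $R$ is a complete, reduced, Cohen–Macaulay local ring of dimension $2$ with system of parameters $x-w,\ x-y-z$, and $$\tau_{\rm par}(R)=\tau(R)=(y,z,xw).$$ Regard $H^2_m(R)$ as $\varinjlim_t R/I_t$ with $I_t=((x-w)^t,(x-y-z)^t)$ and transition maps $R/I_t\to R/I_{t+1}$ given by multiplication by $(x-w)(x-y-z)$,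 and let $F\colon H^2_m(R)\to H^2_m(R)$, $F([r+I_t])=[r^p+I_{tp}]$, be its Frobenius action. A submodule $N$ of $H^2_m(R)$ is $F$-stable if $F(N)\subseteq N$, and an ideal $J$ is an $F$-ideal if $\mathrm{Ann}_{H^2_m(R)}(J)$ is $F$-stable. Let $N=\mathrm{Ann}_{H^2_m(R)}(\tau_{\rm par}(R))$. Note that $I_p=(x^p-w^p,\ x^p-y^p-z^p)$, and put $$\eta=[(xw)^{p-1}+(x^p-w^p,\ x^p-y^p-z^p)]\in H^2_m(R).$$ Then $\eta\in N$ but $F(\eta)\notin N$. Hence $N$ is not $F$-stable, $0^*_{H^2_m(R)}\subsetneq N$, and $\tau_{\rm par}(R)$ is not an $F$-ideal. -/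

import Mathlib

open scoped TensorProduct

universe u v

noncomputable section

/-! ### Local algebra -/

section LocalAlgebra

variable (R : Type u) [CommRing R] [IsLocalRing R]

/-- A sequence `f` of `d` elements of a local ring `R` is a system of parameters if `d = dim R` and
the ideal `(f)` is primary to the maximal ideal, that is, its radical is the maximal ideal. -/
def IsSystemOfParameters {d : ℕ} (f : Fin d → R) : Prop :=
  (d : WithBot ℕ∞) = ringKrullDim R ∧
    (Ideal.span (Set.range f)).radical = IsLocalRing.maximalIdeal R

/-- A local ring is Cohen–Macaulay if it is Noetherian and its maximal ideal contains a regular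
sequence of length `dim R` (that is, depth equals dimension). -/
def IsCohenMacaulayLocal : Prop :=
  IsNoetherianRing R ∧ ∃ rs : List R, (∀ r ∈ rs, r ∈ IsLocalRing.maximalIdeal R) ∧
    RingTheory.Sequence.IsRegular R rs ∧ (rs.length : WithBot ℕ∞) = ringKrullDim R

end LocalAlgebra

/-! ### The Frobenius functor and tight closure -/

section TightClosure

variable (R : Type u) [CommRing R] (p : ℕ) [Fact p.Prime] [CharP R p]

/-- The ring `R`, to be regarded as an `R`-algebra through the `e`-th iterate of Frobenius. -/
@[nolint unusedArguments]
def FrobTwist (_p _e : ℕ) : Type u := R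

instance (e : ℕ) : CommRing (FrobTwist R p e) := inferInstanceAs (CommRing R)

instance (e : ℕ) : Algebra R (FrobTwist R p e) := (iterateFrobenius R p e).toAlgebra

/-- An element of `R`, regarded as an element of `FrobTwist R p e`. -/
def FrobTwist.mk (e : ℕ) : R ≃+* FrobTwist R p e := RingEquiv.refl R

theorem FrobTwist.algebraMap_apply (e : ℕ) (r : R) :
    algebraMap R (FrobTwist R p e) r = FrobTwist.mk R p e (r ^ p ^ e) := rfl

/-- `F^e(M) = R^e ⊗_R M`. -/
abbrev FrobFunctor (e : ℕ) (M : Type v) [AddCommGroup M] [Module R M] : Type (max u v) :=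
  FrobTwist R p e ⊗[R] M

/-- The element `c m^q = c ⊗ m` of `F^e(M)`, where `q = p ^ e`. -/
def frobTmul (e : ℕ) {M : Type v} [AddCommGroup M] [Module R M] (c : R) (m : M) :
    FrobFunctor R p e M :=
  FrobTwist.mk R p e c ⊗ₜ[R] m

variable {R}

/-- `N^{[q]}_M`: the image of `F^e(N) → F^e(M)`, where `q = p ^ e`. -/
def frobPower (e : ℕ) {M : Type v} [AddCommGroup M] [Module R M] (N : Submodule R M) :
    Submodule (FrobTwist R p e) (FrobFunctor R p e M) :=
  LinearMap.range (N.subtype.baseChange (FrobTwist R p e))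

variable (R) in
/-- `R^o`: the complement of the union of the minimal primes of `R`. -/
def offMinimalPrimes : Set R := {c | ∀ P ∈ minimalPrimes R, c ∉ P}

/-- The tight closure `N^*_M` of the submodule `N` in `M`: all `m` for which there is `c ∈ R^o`
with `c m^q ∈ N^{[q]}_M` for all sufficiently large `q = p ^ e`. -/
def tightClosure {M : Type v} [AddCommGroup M] [Module R M] (N : Submodule R M) :
    Submodule R M where
  carrier := {m | ∃ c ∈ offMinimalPrimes R, ∃ e₀ : ℕ, ∀ e ≥ e₀,
    frobTmul R p e c m ∈ frobPower p e N}
  zero_mem' := by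
    refine ⟨1, fun P hP h => ?_, 0, fun e _ => ?_⟩
    · exact hP.1.1.ne_top ((Ideal.eq_top_iff_one P).2 h)
    · simp [frobTmul]
  add_mem' := by
    rintro m₁ m₂ ⟨c₁, hc₁, e₁, h₁⟩ ⟨c₂, hc₂, e₂, h₂⟩
    refine ⟨c₁ * c₂, fun P hP h => ?_, max e₁ e₂, fun e he => ?_⟩
    · exact (hP.1.1.mem_or_mem h).elim (hc₁ P hP) (hc₂ P hP)
    · have k₁ := Submodule.smul_mem _ (FrobTwist.mk R p e c₂) (h₁ e (le_of_max_le_left he))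
      have k₂ := Submodule.smul_mem _ (FrobTwist.mk R p e c₁) (h₂ e (le_of_max_le_right he))
      have k := Submodule.add_mem _ k₁ k₂
      simp only [frobTmul, TensorProduct.smul_tmul', smul_eq_mul, ← map_mul] at k
      rw [mul_comm c₂ c₁, ← TensorProduct.tmul_add] at k
      exact k
  smul_mem' := by
    rintro r m ⟨c, hc, e₀, h⟩
    refine ⟨c, hc, e₀, fun e he => ?_⟩
    have k := Submodule.smul_mem _ (algebraMap R (FrobTwist R p e) r) (h e he)
    rw [algebraMap_smul] at k
    simpa only [frobTmul, TensorProduct.tmul_smul] using k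

variable (R)

/-- The test ideal `τ(R)`: the intersection of the annihilators of `0^*_M` over all finitely
generated `R`-modules `M`. -/
def testIdeal : Ideal R :=
  ⨅ (M : Type u) (_ : AddCommGroup M) (_ : Module R M) (_ : Module.Finite R M),
    Module.annihilator R (tightClosure p (⊥ : Submodule R M))

/-- The parameter test ideal `τ_par(R)`: the intersection of the ideals `I : I^*` over all ideals
`I` generated by a system of parameters. -/
def parameterTestIdeal [IsLocalRing R] : Ideal R :=
  ⨅ (d : ℕ) (f : Fin d → R) (_ : IsSystemOfParameters R f),
    (Ideal.span (Set.range f)).colon (tightClosure p (Ideal.span (Set.range f)) : Set R)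

end TightClosure

/-! ### Top local cohomology and its Frobenius action -/

section LocalCohomology

variable {R : Type u} [CommRing R] {d : ℕ} (x : Fin d → R)

/-- The ideal `I_t = (x_1 ^ t, …, x_d ^ t)`. -/
def powIdeal (t : ℕ) : Ideal R := Ideal.span (Set.range fun i => x i ^ t)

/-- The map `R / I_s → R / I_t`, for `s ≤ t`, given by multiplication by `(x_1 ⋯ x_d) ^ (t - s)`. -/
def powTransition (s t : ℕ) (h : s ≤ t) : (R ⧸ powIdeal x s) →ₗ[R] (R ⧸ powIdeal x t) :=
  Submodule.mapQ (powIdeal x s) (powIdeal x t) (LinearMap.mulLeft R ((∏ i, x i) ^ (t - s))) (by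
    rw [powIdeal, Ideal.span, Submodule.span_le]
    rintro _ ⟨i, rfl⟩
    change (∏ i, x i) ^ (t - s) * x i ^ s ∈ powIdeal x t
    obtain ⟨c, hc⟩ := pow_dvd_pow_of_dvd (Finset.dvd_prod_of_mem x (Finset.mem_univ i)) (t - s)
    have : (∏ i, x i) ^ (t - s) * x i ^ s = c * x i ^ t := by
      rw [hc, mul_right_comm, ← pow_add, Nat.sub_add_cancel h, mul_comm]
    rw [this]
    exact Ideal.mul_mem_left _ _ (Ideal.subset_span ⟨i, rfl⟩))

/-- The top local cohomology module `H^d_m(R)`, computed from a system of parameters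
`x_1, …, x_d` of the Noetherian local ring `R` as the direct limit of the modules `R / I_t`. -/
abbrev TopLocalCohomology : Type u :=
  Module.DirectLimit (fun t => R ⧸ powIdeal x t) (powTransition x)

/-- The class `[r + I_t]` in the top local cohomology module. -/
def topClass (t : ℕ) (r : R) : TopLocalCohomology x :=
  Module.DirectLimit.of R ℕ (fun t => R ⧸ powIdeal x t) (powTransition x) t
    (Ideal.Quotient.mk (powIdeal x t) r)

theorem topClass_add (t : ℕ) (r s : R) :
    topClass x t (r + s) = topClass x t r + topClass x t s := by
  simp [topClass]

theorem topClass_smul (t : ℕ) (r s : R) : topClass x t (r * s) = r • topClass x t s := by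
  rw [topClass, topClass, ← map_smul]
  rfl

theorem topClass_eq_zero (t : ℕ) {r : R} (h : r ∈ powIdeal x t) : topClass x t r = 0 := by
  rw [topClass, Ideal.Quotient.eq_zero_iff_mem.2 h, map_zero]

theorem topClass_transition (s t : ℕ) (h : s ≤ t) (r : R) :
    topClass x t ((∏ i, x i) ^ (t - s) * r) = topClass x s r :=
  Module.DirectLimit.of_f (R := R) (ι := ℕ) (G := fun t => R ⧸ powIdeal x t)
    (f := powTransition x) (i := s) (j := t) (hij := h) (x := Ideal.Quotient.mk (powIdeal x s) r)

theorem exists_topClass (h : TopLocalCohomology x) : ∃ t r, topClass x t r = h := by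
  obtain ⟨t, y, rfl⟩ := Module.DirectLimit.exists_of h
  obtain ⟨r, rfl⟩ := Ideal.Quotient.mk_surjective y
  exact ⟨t, r, rfl⟩

variable (p : ℕ) [Fact p.Prime] [CharP R p]

theorem pow_mem_powIdeal (t : ℕ) {r : R} (h : r ∈ powIdeal x t) : r ^ p ∈ powIdeal x (t * p) := by
  have hle : powIdeal x t ≤ (powIdeal x (t * p)).comap (frobenius R p) := by
    refine Ideal.span_le.2 ?_
    rintro _ ⟨i, rfl⟩
    refine Ideal.subset_span ⟨i, ?_⟩
    simp [frobenius_def, pow_mul]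
  exact hle h

/-- The `R`-module `H^d_m(R)` with scalars restricted along the Frobenius `R → R`. -/
def TopFrobRestrict (_p : ℕ) : Type u := TopLocalCohomology x

instance : AddCommGroup (TopFrobRestrict x p) :=
  inferInstanceAs (AddCommGroup (TopLocalCohomology x))

instance : Module R (TopFrobRestrict x p) :=
  Module.compHom (TopLocalCohomology x) (frobenius R p)

/-- The map `R / I_t → H^d_m(R)`, `r + I_t ↦ [r ^ p + I_{tp}]`. -/
def topFrobeniusAux (t : ℕ) : (R ⧸ powIdeal x t) →ₗ[R] TopFrobRestrict x p :=
  Submodule.liftQ (powIdeal x t)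
    { toFun := fun r => (topClass x (t * p) (r ^ p) : TopLocalCohomology x)
      map_add' := fun r s => by
        rw [add_pow_char, topClass_add]
        rfl
      map_smul' := fun r s => by
        rw [smul_eq_mul, mul_pow, topClass_smul]
        rfl }
    (fun _ h => topClass_eq_zero x _ (pow_mem_powIdeal x p t h))

theorem topFrobeniusAux_transition (s t : ℕ) (h : s ≤ t) (y : R ⧸ powIdeal x s) :
    topFrobeniusAux x p t (powTransition x s t h y) = topFrobeniusAux x p s y := by
  obtain ⟨r, rfl⟩ := Ideal.Quotient.mk_surjective y
  change topClass x (t * p) (((∏ i, x i) ^ (t - s) * r) ^ p) = topClass x (s * p) (r ^ p)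
  rw [mul_pow, ← pow_mul, Nat.sub_mul]
  exact topClass_transition x _ _ (Nat.mul_le_mul_right p h) _

/-- The Frobenius action `F : H^d_m(R) → H^d_m(R)`, `[r + I_t] ↦ [r ^ p + I_{tp}]`; it is additive
and satisfies `F (a • h) = a ^ p • F h`. -/
def topFrobenius : TopLocalCohomology x →ₛₗ[frobenius R p] TopLocalCohomology x :=
  let F : TopLocalCohomology x →ₗ[R] TopFrobRestrict x p :=
    Module.DirectLimit.lift R ℕ _ (powTransition x) (topFrobeniusAux x p)
      (topFrobeniusAux_transition x p)
  { toFun := F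
    map_add' := F.map_add
    map_smul' := F.map_smul }

theorem topFrobenius_topClass (t : ℕ) (r : R) :
    topFrobenius x p (topClass x t r) = topClass x (t * p) (r ^ p) :=
  Module.DirectLimit.lift_of (R := R) (ι := ℕ) (G := fun t => R ⧸ powIdeal x t)
    (f := powTransition x) (topFrobeniusAux x p) (topFrobeniusAux_transition x p)
    (Ideal.Quotient.mk (powIdeal x t) r)

/-- A submodule `N` of `H^d_m(R)` is `F`-stable if `F(N) ⊆ N`. -/
def IsFStable (N : Submodule R (TopLocalCohomology x)) : Prop :=
  ∀ h ∈ N, topFrobenius x p h ∈ N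

/-- `Ann_{H^d_m(R)}(J)`: the elements of `H^d_m(R)` that are killed by the ideal `J`. -/
def annTop (J : Ideal R) : Submodule R (TopLocalCohomology x) where
  carrier := {h | ∀ a ∈ J, a • h = 0}
  zero_mem' := fun a _ => smul_zero a
  add_mem' := fun h₁ h₂ a ha => by rw [smul_add, h₁ a ha, h₂ a ha, add_zero]
  smul_mem' := fun r h hh a ha => by rw [smul_comm, hh a ha, smul_zero]

/-- An ideal `J` is an `F`-ideal if its annihilator in `H^d_m(R)` is `F`-stable. -/
def IsFIdeal (J : Ideal R) : Prop := IsFStable x p (annTop x J)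

end LocalCohomology

/-! ### The ring `K[[x, y, z, w]] / (xy, yz, zw)` -/

namespace PathRing

open MvPowerSeries

variable (K : Type u) [Field K]

/-- The ideal `(xy, yz, zw)` of `K[[x, y, z, w]]`; the variables `x, y, z, w` have the indices
`0, 1, 2, 3`. -/
def relations : Ideal (MvPowerSeries (Fin 4) K) :=
  Ideal.span {X 0 * X 1, X 1 * X 2, X 2 * X 3}

end PathRing

/-- The ring `R = K[[x, y, z, w]] / (xy, yz, zw)`. -/
abbrev PathRing (K : Type u) [Field K] : Type u :=
  MvPowerSeries (Fin 4) K ⧸ PathRing.relations K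

namespace PathRing

variable (K : Type u) [Field K]

/-- The class of `x` in `R`. -/
def x : PathRing K := Ideal.Quotient.mk (relations K) (MvPowerSeries.X 0)

/-- The class of `y` in `R`. -/
def y : PathRing K := Ideal.Quotient.mk (relations K) (MvPowerSeries.X 1)

/-- The class of `z` in `R`. -/
def z : PathRing K := Ideal.Quotient.mk (relations K) (MvPowerSeries.X 2)

/-- The class of `w` in `R`. -/
def w : PathRing K := Ideal.Quotient.mk (relations K) (MvPowerSeries.X 3)

theorem relations_le :
    relations K ≤ RingHom.ker (MvPowerSeries.constantCoeff (σ := Fin 4) (R := K)) := by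
  refine Ideal.span_le.2 ?_
  rintro _ (rfl | rfl | rfl) <;> simp

instance : Nontrivial (PathRing K) :=
  Ideal.Quotient.nontrivial_iff.2 fun h => by
    have : (1 : MvPowerSeries (Fin 4) K) ∈ relations K := h ▸ Submodule.mem_top
    simpa using relations_le K this

instance : IsLocalRing (PathRing K) :=
  IsLocalRing.of_surjective' (Ideal.Quotient.mk (relations K)) Ideal.Quotient.mk_surjective

instance (p : ℕ) [CharP K p] : CharP (PathRing K) p :=
  charP_of_injective_algebraMap (algebraMap K (PathRing K)).injective p

/-- The sequence `x - w, x - y - z` in `R`. -/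
def params : Fin 2 → PathRing K := ![x K - w K, x K - y K - z K]

theorem powIdeal_params (p : ℕ) [Fact p.Prime] [CharP K p] (e : ℕ) :
    powIdeal (params K) (p ^ e) = Ideal.span
      {x K ^ p ^ e - w K ^ p ^ e, x K ^ p ^ e - y K ^ p ^ e - z K ^ p ^ e} := by
  rw [powIdeal]
  congr 1
  ext r
  simp [params, Fin.exists_fin_two, sub_pow_char_pow, eq_comm]

end PathRing

end

/-! The minimal primes of `R` are `(y, w)`, `(y, z)`, `(x, z)`, and `R` embeds in the product of the
quotients `K⟦x, z⟧`, `K⟦x, w⟧`, `K⟦w, y⟧`, called components 0, 1, 2. The elements `z`, `xw`, `y`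
(`comp`) each vanish on all components but one, so `comp j` kills the kernel `P_j` of the `j`-th
projection.

Lower bound for the test ideals: in a power series ring over a field the ideals `(X_s ^ n)` are
tightly closed, by a socle argument (`mem_powSpan_of_mul_pow_mem`). Duality with linear forms and
Krull's intersection theorem extend this to modules: `0^*_M ⊆ P_j M` for finitely generated `M`
(`mem_ker_smul_top_of_frobTmul_eq_zero`). Hence `comp j` kills `0^*_M`, and `(y, z, xw) ⊆ τ ⊆
τ_par`.

Upper bound: for `q = p ^ e`, the element `x ^ q` agrees on every component with some element of
`I_q`, so it lies in `I_q^*`. If `r x ^ q ∈ I_q`, then on the middle component `r` has no pure power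
of `x` or `w` of exponent below `q`, because the components are glued along the axes
(`coeff_proj_one_eq_zero_of_mul_x_pow_mem`). Letting `q` grow, `r` is divisible by `xw` on the
middle component, that is, `r ∈ (y, z, xw)`.

Local cohomology: if `[r + I_q]` lies in `0^*`, then each projection of `r` lies in `(X_0 ^ q, X_1 ^
q)`, so every `comp j` kills the class and `0^* ⊆ N`. The class `η` is killed by `xw` since `(xw) ^
p ∈ I_p`, and by `y`, `z` since it vanishes on the outer components. But `xw F(η)` is represented at
level `p ^ 2` by the power of `xw` with exponent `p(p - 1) + 1 < p ^ 2`, which is nonzero on the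
middle component. Frobenius multiplies the distance of `η` from zero, while `N` only tolerates a
fixed factor `xw`. -/

namespace MvPowerSeries

/-! ### Monomial ideals in power series rings -/

section Monomial

variable {σ : Type*} {K : Type*} [CommRing K]

/-- Membership in an ideal generated by finitely many monomials is tested monomial by monomial. -/
theorem mem_span_monomial_iff (A : Finset (σ →₀ ℕ)) (f : MvPowerSeries σ K) :
    f ∈ Ideal.span ((fun m => monomial m (1 : K)) '' (A : Set (σ →₀ ℕ))) ↔
      ∀ n, coeff n f ≠ 0 → ∃ m ∈ A, m ≤ n := by
  classical
  constructor
  · intro hf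
    refine Submodule.span_induction (p := fun f _ => ∀ n, coeff n f ≠ 0 → ∃ m ∈ A, m ≤ n)
      ?_ ?_ ?_ ?_ hf
    · rintro _ ⟨m, hm, rfl⟩ n hn
      exact ⟨m, hm, (eq_of_coeff_monomial_ne_zero hn).ge⟩
    · intro n hn
      simp at hn
    · intro f g _ _ hf hg n hn
      by_cases h : coeff n f = 0
      · exact hg n fun h' => hn (by rw [map_add, h, h', add_zero])
      · exact hf n h
    · intro r f _ hf n hn
      rw [smul_eq_mul, coeff_mul] at hn
      obtain ⟨⟨i, j⟩, hij, h⟩ := Finset.exists_ne_zero_of_sum_ne_zero hn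
      obtain ⟨m, hm, hmj⟩ := hf j (right_ne_zero_of_mul h)
      rw [Finset.HasAntidiagonal.mem_antidiagonal] at hij
      exact ⟨m, hm, hmj.trans (hij ▸ le_add_self)⟩
  · induction A using Finset.induction_on generalizing f with
    | empty =>
      intro h
      have : f = 0 := by
        ext n
        by_contra hn
        simpa using h n hn
      simp [this]
    | insert a A ha ih =>
      intro h
      -- Split off the terms divisible by the monomial with exponent `a`; the remaining terms are
      -- handled by the other generators.
      let g : MvPowerSeries σ K := fun n => coeff (a + n) f
      let f' : MvPowerSeries σ K := fun n => if a ≤ n then 0 else coeff n f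
      have hf : f = g * monomial a 1 + f' := by
        ext n
        rw [map_add, coeff_mul_monomial]
        change _ = (if a ≤ n then coeff (a + (n - a)) f * 1 else 0) +
          (if a ≤ n then 0 else coeff n f)
        split_ifs with h
        · rw [add_tsub_cancel_of_le h]; simp
        · simp
      rw [hf]
      refine Ideal.add_mem _ (Ideal.mul_mem_left _ _ (Ideal.subset_span ⟨a, by simp, rfl⟩)) ?_
      refine Ideal.span_mono (Set.image_mono (by simp)) (ih f' fun n hn => ?_)
      change (if a ≤ n then 0 else coeff n f) ≠ 0 at hn
      split_ifs at hn with han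
      · exact absurd rfl hn
      · obtain ⟨m, hm, hmn⟩ := h n hn
        rw [Finset.mem_insert] at hm
        rcases hm with rfl | hm
        · exact absurd hmn han
        · exact ⟨m, hm, hmn⟩

variable (σ K) in
/-- The ideal generated by the `n`-th powers of the variables. -/
noncomputable def powSpan (n : ℕ) : Ideal (MvPowerSeries σ K) :=
  Ideal.span (Set.range fun s => X s ^ n)

theorem mem_powSpan_iff [Finite σ] {n : ℕ} {f : MvPowerSeries σ K} :
    f ∈ powSpan σ K n ↔ ∀ k, coeff k f ≠ 0 → ∃ s, n ≤ k s := by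
  classical
  have := Fintype.ofFinite σ
  have h : powSpan σ K n = Ideal.span ((fun m => monomial m (1 : K)) ''
      ((Finset.univ.image fun s : σ => Finsupp.single s n : Finset (σ →₀ ℕ)) :
        Set (σ →₀ ℕ))) := by
    rw [powSpan]
    congr 1
    ext f
    simp [X_pow_eq]
  rw [h, mem_span_monomial_iff]
  simp

theorem X_pow_mem_powSpan {n m : ℕ} (h : n ≤ m) (s : σ) : X s ^ m ∈ powSpan σ K n :=
  Ideal.mem_of_dvd _ (pow_dvd_pow _ h) (Ideal.subset_span ⟨s, rfl⟩)

theorem pow_char_pow_mem_powSpan (p : ℕ) [Fact p.Prime] [CharP K p] (e : ℕ) {n : ℕ}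
    {f : MvPowerSeries σ K} (h : f ∈ powSpan σ K n) : f ^ p ^ e ∈ powSpan σ K (n * p ^ e) := by
  have : CharP (MvPowerSeries σ K) p := charP_of_injective_ringHom C_injective p
  have hle : powSpan σ K n ≤
      (powSpan σ K (n * p ^ e)).comap (iterateFrobenius (MvPowerSeries σ K) p e) := by
    refine Ideal.span_le.2 ?_
    rintro _ ⟨i, rfl⟩
    refine Ideal.subset_span ⟨i, ?_⟩
    simp [iterateFrobenius_def, pow_mul]
  exact hle h

end Monomial

/-! ### Tight closedness of the ideals `(X_s ^ n)` -/

section TightlyClosed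

variable {σ : Type*} [Finite σ] {K : Type*} [Field K]

/-- The exponent of the socle generator of `K⟦σ⟧ / (X_s ^ n)`. -/
noncomputable def socleExp (σ : Type*) [Finite σ] (n : ℕ) : σ →₀ ℕ :=
  Finsupp.equivFunOnFinite.symm fun _ => n - 1

@[simp] theorem socleExp_apply (n : ℕ) (s : σ) : socleExp σ n s = n - 1 := rfl

/-- Multiplication by the monomial raises each exponent by `q(n - 1)`, and `nq - q(n - 1) = q`. -/
theorem monomial_socleExp_mul_mem_powSpan {n q : ℕ} (hn : 0 < n) {c : MvPowerSeries σ K}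
    (h : c * monomial (q • socleExp σ n) 1 ∈ powSpan σ K (n * q)) : c ∈ powSpan σ K q := by
  classical
  rw [mem_powSpan_iff] at h ⊢
  intro k hk
  obtain ⟨s, hs⟩ := h (k + q • socleExp σ n) (by
    rwa [coeff_add_mul_monomial, mul_one])
  refine ⟨s, ?_⟩
  obtain ⟨n, rfl⟩ := Nat.exists_eq_succ_of_ne_zero hn.ne'
  simp only [Finsupp.add_apply, Finsupp.smul_apply, socleExp_apply, smul_eq_mul] at hs
  simp only [Nat.succ_eq_add_one, Nat.add_sub_cancel] at hs
  nlinarith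

theorem eq_zero_of_forall_mem_powSpan {c : MvPowerSeries σ K} [Nonempty σ]
    (h : ∀ n, ∃ m ≥ n, c ∈ powSpan σ K m) : c = 0 := by
  ext k
  by_contra hk
  obtain ⟨m, hm, hc⟩ := h (k.degree + 1)
  obtain ⟨s, hs⟩ := mem_powSpan_iff.1 hc k hk
  have := Finsupp.le_degree s k
  omega

/-- If `r ∉ (X_s ^ n)`, then a multiple of `r` is a socle generator modulo `(X_s ^ n)`. -/
theorem exists_mul_sub_socle_mem {n : ℕ} {r : MvPowerSeries σ K} (h : r ∉ powSpan σ K n) :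
    ∃ t, t * r - monomial (socleExp σ n) 1 ∈ powSpan σ K n := by
  classical
  have hex : ∃ k : σ →₀ ℕ, coeff k r ≠ 0 ∧ ∀ s, k s < n := by
    by_contra! hc
    exact h (mem_powSpan_iff.2 hc)
  -- Let `N` be the socle exponent and `k` a minimal exponent of `r` in the box below `n`. After
  -- multiplication by the monomial of exponent `N - k`, a term of `r` stays in the box only if its
  -- exponent is `≤ k`, so only the term at `k` survives.
  obtain ⟨k, ⟨hk, hkn⟩, hmin⟩ := WellFounded.has_min (wellFounded_lt (α := σ →₀ ℕ))
    {k : σ →₀ ℕ | coeff k r ≠ 0 ∧ ∀ s, k s < n} hex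
  have hkN : k ≤ socleExp σ n := fun s => by
    have := hkn s
    simp only [socleExp_apply]; omega
  refine ⟨monomial (socleExp σ n - k) (coeff k r)⁻¹, mem_powSpan_iff.2 fun l hl => ?_⟩
  by_contra! hln
  apply hl
  rw [map_sub, coeff_monomial_mul, coeff_monomial]
  have hlN : l ≤ socleExp σ n := fun s => by
    have := hln s
    simp only [socleExp_apply]; omega
  by_cases hlk : l = socleExp σ n
  · subst hlk
    rw [if_pos tsub_le_self, if_pos rfl, tsub_tsub_cancel_of_le hkN, inv_mul_cancel₀ hk, sub_self]
  · rw [if_neg hlk, sub_zero]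
    split_ifs with hle
    · have hle' : l - (socleExp σ n - k) ≤ k := fun s => by
        have h1 := hlN s
        have h2 := hkN s
        simp only [Finsupp.tsub_apply, socleExp_apply] at *
        omega
      have hne : l - (socleExp σ n - k) ≠ k := fun he => hlk <| by
        ext s
        have h1 := hlN s
        have h2 := hkN s
        have h3 := hle s
        have h4 := DFunLike.congr_fun he s
        simp only [Finsupp.tsub_apply, socleExp_apply] at *
        omega
      have := hmin (l - (socleExp σ n - k))
      by_cases h0 : coeff (l - (socleExp σ n - k)) r = 0
      · rw [h0, mul_zero]
      · exact absurd (lt_of_le_of_ne hle' hne)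
          (this ⟨h0, fun s => (hle' s).trans_lt (hkn s)⟩)
    · rfl

/-- The ideals `(X_s ^ n)` of a power series ring are tightly closed. -/
theorem mem_powSpan_of_mul_pow_mem [Nonempty σ] (p : ℕ) [Fact p.Prime] [CharP K p] {n e₀ : ℕ}
    {c r : MvPowerSeries σ K} (hc : c ≠ 0)
    (h : ∀ e ≥ e₀, c * r ^ p ^ e ∈ powSpan σ K (n * p ^ e)) : r ∈ powSpan σ K n := by
  by_contra hr
  have hn : 0 < n := by
    rcases Nat.eq_zero_or_pos n with rfl | hn
    · exact absurd (mem_powSpan_iff.2 fun k _ => ⟨Classical.arbitrary σ, Nat.zero_le _⟩) hr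
    · exact hn
  obtain ⟨t, ht⟩ := exists_mul_sub_socle_mem hr
  -- Since `t r` is the socle monomial modulo `(X_s ^ n)`, raising to the power `q = p ^ e` puts `c`
  -- times the `q`-th power of that monomial into `(X_s ^ (nq))`. Hence `c ∈ (X_s ^ q)` for
  -- arbitrarily large `q`.
  refine hc (eq_zero_of_forall_mem_powSpan fun m => ?_)
  have hp : 1 < p := (Fact.out : p.Prime).one_lt
  refine ⟨p ^ max m e₀, (Nat.lt_pow_self hp).le.trans
    (Nat.pow_le_pow_right hp.le (le_max_left _ _)),
    monomial_socleExp_mul_mem_powSpan (n := n) hn ?_⟩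
  set e := max m e₀
  have : CharP (MvPowerSeries σ K) p := charP_of_injective_ringHom C_injective p
  have h1 := pow_char_pow_mem_powSpan p e ht
  rw [sub_pow_char_pow, mul_pow, monomial_pow, one_pow] at h1
  have h2 := Ideal.mul_mem_left _ (t ^ p ^ e) (h e (le_max_right _ _))
  have h3 := Ideal.sub_mem _ h2 (Ideal.mul_mem_left _ c h1)
  convert h3 using 1
  ring

end TightlyClosed

end MvPowerSeries

/-! ### Divisibility by powers of variables -/

namespace MvPowerSeries

variable {σ : Type*} {K : Type*} [CommRing K]

theorem X_pow_dvd_of_dvd_X_pow_mul {s t : σ} (hst : s ≠ t) {n k : ℕ} {f : MvPowerSeries σ K}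
    (h : X s ^ n ∣ X t ^ k * f) : X s ^ n ∣ f := by
  classical
  rw [X_pow_dvd_iff] at h ⊢
  intro m hm
  have := h (Finsupp.single t k + m) (by simpa [Finsupp.single_apply, hst.symm] using hm)
  rwa [X_pow_eq, coeff_add_monomial_mul, one_mul] at this

theorem X_dvd_of_dvd_X_mul {s t : σ} (hst : s ≠ t) {f : MvPowerSeries σ K}
    (h : X s ∣ X t * f) : X s ∣ f := by
  simpa using X_pow_dvd_of_dvd_X_pow_mul hst (n := 1) (k := 1) (by simpa using h)

theorem coeff_X_pow_mul_eq_zero {s : σ} {n : ℕ} {m : σ →₀ ℕ} (hm : m s < n)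
    (f : MvPowerSeries σ K) : coeff m (X s ^ n * f) = 0 :=
  X_pow_dvd_iff.1 (dvd_mul_right _ _) m hm

theorem X_zero_mul_X_one_dvd {f : MvPowerSeries (Fin 2) K}
    (h0 : ∀ n, coeff (Finsupp.single 0 n) f = 0) (h1 : ∀ n, coeff (Finsupp.single 1 n) f = 0) :
    X 0 * X 1 ∣ f := by
  have hs : ∀ (i j : Fin 2) (_ : i ≠ j) (m : Fin 2 →₀ ℕ), m i = 0 →
      m = Finsupp.single j (m j) := by
    intro i j hij m hm
    ext l
    fin_cases i <;> fin_cases j <;> fin_cases l <;> simp_all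
  obtain ⟨g, rfl⟩ : X 0 ∣ f := X_dvd_iff.2 fun m hm => by
    rw [hs 0 1 (by decide) m hm]; exact h1 _
  refine mul_dvd_mul_left _ (X_dvd_of_dvd_X_mul (t := 0) (by decide) ?_)
  exact X_dvd_iff.2 fun m hm => by
    rw [hs 1 0 (by decide) m hm]; exact h0 _

end MvPowerSeries

/-! ### The three components of `R`, reducedness and minimal primes -/

namespace PathRing

open MvPowerSeries

variable (K : Type u) [Field K]

/-- The pairs of variables that span the three components `(x, z)`, `(x, w)`, `(w, y)`. -/
def branch (j : Fin 3) : Fin 2 ↪ Fin 4 :=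
  ⟨![![0, 2], ![0, 3], ![3, 1]] j, by fin_cases j <;> decide⟩

theorem killCompl_branch_X (j : Fin 3) (i : Fin 4) :
    killCompl (branch j) (X i : MvPowerSeries (Fin 4) K) =
      ![![X 0, 0, X 1, 0], ![X 0, 0, 0, X 1], ![0, X 1, 0, X 0]] j i := by
  by_cases h : i ∈ Set.range (branch j)
  · obtain ⟨k, rfl⟩ := h
    rw [killCompl_X]
    fin_cases j <;> fin_cases k <;> rfl
  · rw [killCompl_X_eq_zero h]
    fin_cases j <;> fin_cases i <;> first | rfl | (exfalso; revert h; simp; decide)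

theorem relations_le_ker (j : Fin 3) :
    relations K ≤ RingHom.ker (killCompl (R := K) (branch j)) := by
  refine Ideal.span_le.2 ?_
  rintro _ (rfl | rfl | rfl) <;> fin_cases j <;>
    simp [killCompl_branch_X]

/-- The projection of `R` to the coordinate ring of its `j`-th component. -/
noncomputable def proj (j : Fin 3) : PathRing K →ₐ[K] MvPowerSeries (Fin 2) K :=
  Ideal.Quotient.liftₐ (relations K) (killCompl (branch j)) fun _ h => relations_le_ker K j h

theorem proj_mk (j : Fin 3) (f : MvPowerSeries (Fin 4) K) :
    proj K j (Ideal.Quotient.mk (relations K) f) = killCompl (branch j) f := rfl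

@[simp] theorem proj_x (j : Fin 3) : proj K j (x K) = ![X 0, X 0, 0] j := by
  rw [x, proj_mk, killCompl_branch_X]; fin_cases j <;> rfl

@[simp] theorem proj_y (j : Fin 3) : proj K j (y K) = ![0, 0, X 1] j := by
  rw [y, proj_mk, killCompl_branch_X]; fin_cases j <;> rfl

@[simp] theorem proj_z (j : Fin 3) : proj K j (z K) = ![X 1, 0, 0] j := by
  rw [z, proj_mk, killCompl_branch_X]; fin_cases j <;> rfl

@[simp] theorem proj_w (j : Fin 3) : proj K j (w K) = ![0, X 1, X 0] j := by
  rw [w, proj_mk, killCompl_branch_X]; fin_cases j <;> rfl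

theorem proj_surjective (j : Fin 3) : Function.Surjective (proj K j) := fun f =>
  ⟨Ideal.Quotient.mk _ (rename (branch j) f), by rw [proj_mk, killCompl_rename_app]⟩

theorem exists_notMem_range_of_proj_eq_zero {j : Fin 3} {f : MvPowerSeries (Fin 4) K}
    (h : proj K j (Ideal.Quotient.mk _ f) = 0) {n : Fin 4 →₀ ℕ} (hn : coeff n f ≠ 0) :
    ∃ i ∉ Set.range (branch j), n i ≠ 0 := by
  by_contra! hc
  have : n ∈ Set.range (Finsupp.embDomain (branch j)) := by
    rw [Finsupp.mem_range_embDomain_iff]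
    intro i hi
    by_contra h'
    exact (Finsupp.mem_support_iff.1 hi) (hc i h')
  obtain ⟨m, rfl⟩ := this
  exact hn (by rw [← coeff_killCompl, ← proj_mk, h, map_zero])

/-- A monomial that vanishes on all components involves a variable from each of `{y, w}`, `{y, z}`,
`{x, z}`, and any such choice contains one of the pairs `xy`, `yz`, `zw`. -/
theorem eq_zero_of_proj {r : PathRing K} (h : ∀ j, proj K j r = 0) : r = 0 := by
  classical
  obtain ⟨f, rfl⟩ := Ideal.Quotient.mk_surjective r
  rw [Ideal.Quotient.eq_zero_iff_mem]
  have hrel : relations K = Ideal.span ((fun m => monomial m (1 : K)) ''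
      (({Finsupp.single 0 1 + Finsupp.single 1 1, Finsupp.single 1 1 + Finsupp.single 2 1,
        Finsupp.single 2 1 + Finsupp.single 3 1} : Finset (Fin 4 →₀ ℕ)) :
        Set (Fin 4 →₀ ℕ))) := by
    rw [relations]
    congr 1
    simp [Set.image_insert_eq, X_def, monomial_mul_monomial]
  rw [hrel, mem_span_monomial_iff]
  intro n hn
  have key : ∀ i k : Fin 4, i ≠ k → n i ≠ 0 → n k ≠ 0 →
      Finsupp.single i 1 + Finsupp.single k 1 ≤ n := by
    intro i k hik hi hk l
    simp only [Finsupp.add_apply, Finsupp.single_apply]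
    split_ifs with h1 h2 h2
    · exact absurd (h1.trans h2.symm) hik
    · subst h1; omega
    · subst h2; omega
    · omega
  have h0 : n 1 ≠ 0 ∨ n 3 ≠ 0 := by
    obtain ⟨i, hi, hni⟩ := exists_notMem_range_of_proj_eq_zero K (h 0) hn
    revert hi hni
    fin_cases i <;> simp [branch] <;> tauto
  have h1 : n 1 ≠ 0 ∨ n 2 ≠ 0 := by
    obtain ⟨i, hi, hni⟩ := exists_notMem_range_of_proj_eq_zero K (h 1) hn
    revert hi hni
    fin_cases i <;> simp [branch] <;> tauto
  have h2 : n 0 ≠ 0 ∨ n 2 ≠ 0 := by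
    obtain ⟨i, hi, hni⟩ := exists_notMem_range_of_proj_eq_zero K (h 2) hn
    revert hi hni
    fin_cases i <;> simp [branch] <;> tauto
  by_cases n1 : n 1 = 0
  · exact ⟨_, by simp, key 2 3 (by decide) (by tauto) (by tauto)⟩
  · rcases h2 with h2 | h2
    · exact ⟨_, by simp, key 0 1 (by decide) h2 n1⟩
    · exact ⟨_, by simp, key 1 2 (by decide) n1 h2⟩

theorem eq_of_proj {r s : PathRing K} (h : ∀ j, proj K j r = proj K j s) : r = s :=
  sub_eq_zero.1 (eq_zero_of_proj K fun j => by rw [map_sub, h, sub_self])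

instance : IsReduced (PathRing K) :=
  ⟨fun _ hr => eq_zero_of_proj K fun j => (hr.map (proj K j)).eq_zero⟩

theorem exists_eq_of_proj_one_eq_zero {r : PathRing K} (h : proj K 1 r = 0) :
    ∃ α β, r = y K * α + z K * β := by
  classical
  obtain ⟨f, rfl⟩ := Ideal.Quotient.mk_surjective r
  have hf : f ∈ Ideal.span ((fun m => monomial m (1 : K)) ''
      (({Finsupp.single 1 1, Finsupp.single 2 1} : Finset (Fin 4 →₀ ℕ)) :
        Set (Fin 4 →₀ ℕ))) := by
    rw [mem_span_monomial_iff]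
    intro n hn
    have h1 : n 1 ≠ 0 ∨ n 2 ≠ 0 := by
      obtain ⟨i, hi, hni⟩ := exists_notMem_range_of_proj_eq_zero K h hn
      revert hi hni
      fin_cases i <;> simp [branch] <;> tauto
    rcases h1 with h1 | h1
    · exact ⟨Finsupp.single 1 1, by simp, by
        rw [Finsupp.single_le_iff]; omega⟩
    · exact ⟨Finsupp.single 2 1, by simp, by
        rw [Finsupp.single_le_iff]; omega⟩
  have hs : Ideal.span ((fun m => monomial m (1 : K)) ''
      (({Finsupp.single 1 1, Finsupp.single 2 1} : Finset (Fin 4 →₀ ℕ)) :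
        Set (Fin 4 →₀ ℕ))) = Ideal.span {X 1, X 2} := by
    congr 1
    simp [Set.image_insert_eq, X_def]
  rw [hs, Ideal.mem_span_pair] at hf
  obtain ⟨a, b, rfl⟩ := hf
  refine ⟨Ideal.Quotient.mk _ a, Ideal.Quotient.mk _ b, ?_⟩
  rw [map_add, map_mul, map_mul, mul_comm, mul_comm (Ideal.Quotient.mk _ b)]
  rfl

/-- Components 0 and 1 meet along the `x`-axis, as components 1 and 2 do along the `w`-axis; this
gluing is what bounds the parameter test ideal from above. -/
theorem coeff_proj_zero_eq (r : PathRing K) (n : ℕ) :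
    coeff (Finsupp.single 0 n) (proj K 0 r) = coeff (Finsupp.single 0 n) (proj K 1 r) := by
  obtain ⟨f, rfl⟩ := Ideal.Quotient.mk_surjective r
  rw [proj_mk, proj_mk, coeff_killCompl, coeff_killCompl, Finsupp.embDomain_single,
    Finsupp.embDomain_single]
  rfl

theorem coeff_proj_one_eq (r : PathRing K) (n : ℕ) :
    coeff (Finsupp.single 1 n) (proj K 1 r) = coeff (Finsupp.single 0 n) (proj K 2 r) := by
  obtain ⟨f, rfl⟩ := Ideal.Quotient.mk_surjective r
  rw [proj_mk, proj_mk, coeff_killCompl, coeff_killCompl, Finsupp.embDomain_single,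
    Finsupp.embDomain_single]
  rfl

/-- A test element supported on the `j`-th component. -/
noncomputable def comp (j : Fin 3) : PathRing K := ![z K, x K * w K, y K] j

theorem proj_comp (i j : Fin 3) :
    proj K i (comp K j) = if i = j then ![X 1, X 0 * X 1, X 1] j else 0 := by
  fin_cases j <;> fin_cases i <;> simp [comp]

theorem proj_comp_self_ne_zero (j : Fin 3) : proj K j (comp K j) ≠ 0 := by
  have hX : ∀ i : Fin 2, (X i : MvPowerSeries (Fin 2) K) ≠ 0 := fun i h => by
    have := congrArg (coeff (Finsupp.single i 1)) h
    simp [coeff_index_single_self_X] at this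
  rw [proj_comp, if_pos rfl]
  fin_cases j
  · exact hX 1
  · exact mul_ne_zero (hX 0) (hX 1)
  · exact hX 1

theorem comp_mul_eq_zero {j : Fin 3} {r : PathRing K} (h : proj K j r = 0) :
    comp K j * r = 0 := by
  refine eq_zero_of_proj K fun i => ?_
  rw [map_mul, proj_comp]
  split_ifs with hij
  · rw [hij, h, mul_zero]
  · rw [zero_mul]

/-- A prime `Q` inside the kernel contains `comp K j * r = 0` for each `r` in the kernel, but not
`comp K j`. -/
theorem ker_proj_mem_minimalPrimes (j : Fin 3) :
    RingHom.ker (proj K j) ∈ minimalPrimes (PathRing K) := by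
  have := NoZeroDivisors.to_isDomain (MvPowerSeries (Fin 2) K)
  refine ⟨⟨RingHom.ker_isPrime _, bot_le⟩, fun Q hQ hle r hr => ?_⟩
  have h0 : comp K j * r ∈ Q := by
    rw [comp_mul_eq_zero K (RingHom.mem_ker.1 hr)]
    exact Q.zero_mem
  exact (hQ.1.mem_or_mem h0).resolve_left fun h =>
    proj_comp_self_ne_zero K j (RingHom.mem_ker.1 (hle h))

theorem proj_ne_zero_of_mem_offMinimalPrimes {c : PathRing K}
    (hc : c ∈ offMinimalPrimes (PathRing K)) (j : Fin 3) : proj K j c ≠ 0 := fun h =>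
  hc _ (ker_proj_mem_minimalPrimes K j) (RingHom.mem_ker.2 h)

theorem mem_offMinimalPrimes_of_proj {c : PathRing K} (h : ∀ j, proj K j c ≠ 0) :
    c ∈ offMinimalPrimes (PathRing K) := fun P hP hcP => by
  refine Set.disjoint_left.1 (Ideal.disjoint_nonZeroDivisors_of_mem_minimalPrimes hP) hcP ?_
  refine mem_nonZeroDivisors_iff_right.2 fun r hr => eq_zero_of_proj K fun j => ?_
  have := congrArg (proj K j) hr
  rw [map_mul, map_zero] at this
  exact (mul_eq_zero.1 this).resolve_right (h j)

theorem comp_sum_mem_offMinimalPrimes :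
    ∑ j, comp K j ∈ offMinimalPrimes (PathRing K) :=
  mem_offMinimalPrimes_of_proj K fun j => by
    rw [map_sum, Finset.sum_eq_single j]
    · exact proj_comp_self_ne_zero K j
    · intro i _ hij
      rw [proj_comp, if_neg hij.symm]
    · simp

theorem span_comp :
    Ideal.span (Set.range (comp K)) = Ideal.span {y K, z K, x K * w K} := by
  congr 1
  ext r
  simp [comp, Fin.exists_fin_succ, eq_comm]
  tauto

end PathRing

/-! ### Adic completeness -/

namespace MvPowerSeries

variable {σ : Type*} {K : Type*} [CommRing K]

theorem coeff_eq_zero_of_mem_span_X_pow {n : ℕ} {f : MvPowerSeries σ K}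
    (h : f ∈ Ideal.span (Set.range (X : σ → MvPowerSeries σ K)) ^ n) {d : σ →₀ ℕ}
    (hd : d.degree < n) : coeff d f = 0 := by
  suffices (n : ℕ∞) ≤ f.order from coeff_of_lt_order (lt_of_lt_of_le (by exact_mod_cast hd) this)
  have h1 : ∀ g ∈ Ideal.span (Set.range (X : σ → MvPowerSeries σ K)), 1 ≤ g.order := by
    intro g hg
    rw [one_le_order_iff_constCoeff_eq_zero, ← RingHom.mem_ker]
    refine (Ideal.span_le.2 ?_ : _ ≤ RingHom.ker (constantCoeff (σ := σ) (R := K))) hg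
    rintro _ ⟨i, rfl⟩
    simp
  refine Submodule.pow_induction_on_left' _ (C := fun n f _ => (n : ℕ∞) ≤ f.order) ?_ ?_ ?_ h
  · intro r; simp
  · intro f g i _ _ hf hg
    exact (le_min hf hg).trans min_order_le_add
  · intro m hm i f _ hf
    refine le_trans ?_ le_order_mul
    push_cast
    rw [add_comm]
    exact add_le_add (h1 m hm) hf

variable [Finite σ]

/-- As `σ` is finite, there are only finitely many monomials of degree `n`, so
`mem_span_monomial_iff` applies to them. -/
theorem mem_span_X_pow_of_coeff_eq_zero {n : ℕ} {f : MvPowerSeries σ K}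
    (h : ∀ d : σ →₀ ℕ, d.degree < n → coeff d f = 0) :
    f ∈ Ideal.span (Set.range (X : σ → MvPowerSeries σ K)) ^ n := by
  classical
  have := Fintype.ofFinite σ
  have hle : Ideal.span ((fun m => monomial m (1 : K)) ''
      ((Finset.finsuppAntidiag (Finset.univ : Finset σ) n : Finset (σ →₀ ℕ)) : Set (σ →₀ ℕ))) ≤
      Ideal.span (Set.range (X : σ → MvPowerSeries σ K)) ^ n := by
    refine Ideal.span_le.2 ?_
    rintro _ ⟨m, hm, rfl⟩
    have hm : ∑ i, m i = n := by simpa using hm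
    change monomial m (1 : K) ∈ _
    rw [monomial_one_eq, Finsupp.prod_fintype _ _ (by simp), ← hm, ← Finset.prod_pow_eq_pow_sum]
    exact Ideal.prod_mem_prod fun i _ =>
      Ideal.pow_mem_pow (Ideal.subset_span (Set.mem_range_self i)) _
  refine hle ((mem_span_monomial_iff _ f).2 fun d hd => ?_)
  have hn : n ≤ d.degree := by
    by_contra! hlt
    exact hd (h d hlt)
  obtain ⟨m, hmd, hm⟩ := Finsupp.exists_le_degree_eq d n hn
  exact ⟨m, by simpa [Finsupp.degree_eq_sum] using hm, hmd⟩

theorem isPrecomplete_span_X :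
    IsPrecomplete (Ideal.span (Set.range (X : σ → MvPowerSeries σ K))) (MvPowerSeries σ K) := by
  rw [isPrecomplete_iff]
  intro f hf
  -- From index `d.degree + 1` on, the coefficient at `d` no longer changes along the Cauchy
  -- sequence.
  let g : MvPowerSeries σ K := fun d => coeff d (f (d.degree + 1))
  refine ⟨g, fun n => ?_⟩
  simp only [SModEq.sub_mem, smul_eq_mul, Ideal.mul_top] at hf ⊢
  refine mem_span_X_pow_of_coeff_eq_zero fun d hd => ?_
  have := coeff_eq_zero_of_mem_span_X_pow (hf (Nat.succ_le_of_lt hd)) (Nat.lt_succ_self d.degree)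
  rw [map_sub] at this ⊢
  rw [← neg_sub, neg_eq_zero]
  exact this

theorem mem_span_X_of_constantCoeff {f : MvPowerSeries σ K} (h : constantCoeff f = 0) :
    f ∈ Ideal.span (Set.range (X : σ → MvPowerSeries σ K)) := by
  rw [← pow_one (Ideal.span _)]
  refine mem_span_X_pow_of_coeff_eq_zero fun d hd => ?_
  have : d = 0 := (Finsupp.degree_eq_zero_iff d).1 (by omega)
  rw [this]
  exact h

end MvPowerSeries

namespace PathRing

open MvPowerSeries

variable (K : Type u) [Field K]

theorem mk_mem_maximalIdeal_iff {f : MvPowerSeries (Fin 4) K} :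
    Ideal.Quotient.mk (relations K) f ∈ IsLocalRing.maximalIdeal (PathRing K) ↔
      constantCoeff f = 0 := by
  rw [IsLocalRing.mem_maximalIdeal, mem_nonunits_iff]
  constructor
  · intro h
    by_contra h0
    exact h ((isUnit_iff_constantCoeff.2 (isUnit_iff_ne_zero.2 h0)).map _)
  · intro h hu
    obtain ⟨g, hg⟩ := hu.exists_right_inv
    obtain ⟨g, rfl⟩ := Ideal.Quotient.mk_surjective g
    rw [← map_mul, ← map_one (Ideal.Quotient.mk (relations K)), Ideal.Quotient.eq] at hg
    have := relations_le K hg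
    simp [h] at this

theorem maximalIdeal_eq :
    IsLocalRing.maximalIdeal (PathRing K) =
      (Ideal.span (Set.range X)).map (Ideal.Quotient.mk (relations K)) := by
  refine le_antisymm (fun r hr => ?_) (Ideal.map_le_iff_le_comap.2 (Ideal.span_le.2 ?_))
  · obtain ⟨f, rfl⟩ := Ideal.Quotient.mk_surjective r
    exact Ideal.mem_map_of_mem _ (mem_span_X_of_constantCoeff ((mk_mem_maximalIdeal_iff K).1 hr))
  · rintro _ ⟨i, rfl⟩
    exact (mk_mem_maximalIdeal_iff K).2 (by simp)

theorem isAdicComplete : IsAdicComplete (IsLocalRing.maximalIdeal (PathRing K)) (PathRing K) := by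
  have : IsPrecomplete (IsLocalRing.maximalIdeal (PathRing K)) (PathRing K) := by
    rw [maximalIdeal_eq]
    refine (IsPrecomplete.map_algebraMap_iff (R := MvPowerSeries (Fin 4) K)).2 ?_
    have := isPrecomplete_span_X (σ := Fin 4) (K := K)
    -- Completion preserves surjections, so an element of the completed quotient lifts to the
    -- completed power series ring, where it comes from a series.
    refine AdicCompletion.of_surjective_iff.1 fun u => ?_
    obtain ⟨v, rfl⟩ := AdicCompletion.map_surjective (Ideal.span (Set.range X))
      (f := (Algebra.linearMap (MvPowerSeries (Fin 4) K) (PathRing K)))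
      Ideal.Quotient.mk_surjective u
    obtain ⟨f, rfl⟩ := AdicCompletion.of_surjective _ _ v
    exact ⟨_, (AdicCompletion.map_of _ _ _).symm⟩
  exact { }

theorem x_mem : x K ∈ IsLocalRing.maximalIdeal (PathRing K) :=
  (mk_mem_maximalIdeal_iff K).2 (by simp)

theorem y_mem : y K ∈ IsLocalRing.maximalIdeal (PathRing K) :=
  (mk_mem_maximalIdeal_iff K).2 (by simp)

theorem z_mem : z K ∈ IsLocalRing.maximalIdeal (PathRing K) :=
  (mk_mem_maximalIdeal_iff K).2 (by simp)

theorem w_mem : w K ∈ IsLocalRing.maximalIdeal (PathRing K) :=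
  (mk_mem_maximalIdeal_iff K).2 (by simp)

theorem x_mul_y : x K * y K = 0 :=
  Ideal.Quotient.eq_zero_iff_mem.2 (Ideal.subset_span (by simp))

theorem y_mul_z : y K * z K = 0 :=
  Ideal.Quotient.eq_zero_iff_mem.2 (Ideal.subset_span (by simp))

theorem z_mul_w : z K * w K = 0 :=
  Ideal.Quotient.eq_zero_iff_mem.2 (Ideal.subset_span (by simp))

/-! ### The parameters, Cohen–Macaulayness and dimension -/

theorem params_mem (i : Fin 2) : params K i ∈ IsLocalRing.maximalIdeal (PathRing K) := by
  fin_cases i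
  · exact Ideal.sub_mem _ (x_mem K) (w_mem K)
  · exact Ideal.sub_mem _ (Ideal.sub_mem _ (x_mem K) (y_mem K)) (z_mem K)

theorem radical_span_params :
    (Ideal.span (Set.range (params K))).radical = IsLocalRing.maximalIdeal (PathRing K) := by
  have hxy := x_mul_y K
  have hyz := y_mul_z K
  have hzw := z_mul_w K
  apply le_antisymm
  · rw [Ideal.IsPrime.radical_le_iff inferInstance, Ideal.span_le]
    rintro _ ⟨i, rfl⟩
    exact params_mem K i
  · have hI : Ideal.span (Set.range (params K)) =
        Ideal.span {x K - w K, x K - y K - z K} := by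
      congr 1
      ext r
      simp [params, or_comm]
    rw [maximalIdeal_eq, Ideal.map_le_iff_le_comap, Ideal.span_le]
    rintro _ ⟨i, rfl⟩
    -- The square of each variable already lies in the ideal of the parameters.
    refine ⟨2, ?_⟩
    rw [hI, Ideal.mem_span_pair]
    fin_cases i
    · exact ⟨x K - y K, w K, by change _ = x K ^ 2; linear_combination -hxy - hzw⟩
    · exact ⟨0, -y K, by change _ = y K ^ 2; linear_combination -hxy + hyz⟩
    · exact ⟨z K, -z K, by change _ = z K ^ 2; linear_combination -hzw + hyz⟩
    · exact ⟨-w K - y K, w K, by change _ = w K ^ 2; linear_combination - hxy - hzw⟩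

theorem proj_params_zero (j : Fin 3) :
    proj K j (params K 0) = ![X 0, X 0 - X 1, -X 0] j := by
  fin_cases j <;> simp [params]

theorem proj_params_one (j : Fin 3) :
    proj K j (params K 1) = ![X 0 - X 1, X 0, -X 1] j := by
  fin_cases j <;> simp [params]

theorem X_ne_zero (i : Fin 2) : (X i : MvPowerSeries (Fin 2) K) ≠ 0 := fun h => by
  have := congrArg (coeff (Finsupp.single i 1)) h
  simp [coeff_index_single_self_X] at this

theorem X_sub_X_ne_zero : (X 0 - X 1 : MvPowerSeries (Fin 2) K) ≠ 0 := fun h => by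
  exact absurd (X_inj.1 (sub_eq_zero.1 h)) (by decide)

theorem params_zero_mul_eq_zero {r : PathRing K} (h : params K 0 * r = 0) : r = 0 := by
  refine eq_zero_of_proj K fun j => ?_
  have := congrArg (proj K j) h
  rw [map_mul, proj_params_zero, map_zero] at this
  refine (mul_eq_zero.1 this).resolve_left ?_
  fin_cases j
  · exact X_ne_zero K 0
  · exact X_sub_X_ne_zero K
  · exact neg_ne_zero.2 (X_ne_zero K 0)

/-- An element of `R` that vanishes on the middle component and whose restrictions to the outer
components are divisible by `x - w` is divisible by `x - w`. -/
theorem params_zero_dvd_of_proj_one_eq_zero {r : PathRing K} (h1 : proj K 1 r = 0)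
    (h0 : X 0 ∣ proj K 0 r) (h2 : X 0 ∣ proj K 2 r) : params K 0 ∣ r := by
  obtain ⟨α, β, rfl⟩ := exists_eq_of_proj_one_eq_zero K h1
  simp only [map_add, map_mul, proj_y, proj_z, Matrix.cons_val_zero, zero_mul, zero_add,
    Matrix.cons_val, add_zero] at h0 h2
  obtain ⟨b, hb⟩ := X_dvd_of_dvd_X_mul (by decide) h0
  obtain ⟨a, ha⟩ := X_dvd_of_dvd_X_mul (by decide) h2
  obtain ⟨b, rfl⟩ := proj_surjective K 0 b
  obtain ⟨a, rfl⟩ := proj_surjective K 2 a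
  -- The sign arises because `x - w` restricts to `x` on component 0 but to `-w` on component 2.
  refine ⟨z K * b - y K * a, eq_of_proj K fun j => ?_⟩
  rw [map_mul, proj_params_zero]
  fin_cases j
  · simp [hb]; ring
  · simp
  · simp [ha]; ring

/-- This is regularity of the second parameter modulo the first. On the middle component,
coprimality of the variables gives a quotient `l`; subtracting `params K 0 * l` leaves an element
vanishing there, and the outer components only require divisibility by a variable. -/
theorem params_zero_dvd_of_dvd_mul {r : PathRing K} (h : params K 0 ∣ params K 1 * r) :
    params K 0 ∣ r := by
  obtain ⟨v, hv⟩ := h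
  have e : ∀ j, _ := fun j => congrArg (proj K j) hv
  simp only [map_mul, proj_params_zero, proj_params_one] at e
  have e0 := e 0
  have e1 := e 1
  have e2 := e 2
  simp only [Matrix.cons_val_zero, Matrix.cons_val_one, Matrix.cons_val] at e0 e1 e2
  have d1 : (X 0 : MvPowerSeries (Fin 2) K) ∣ proj K 1 v :=
    X_dvd_of_dvd_X_mul (t := 1) (by decide)
      ⟨proj K 1 v - proj K 1 r, by linear_combination e1⟩
  obtain ⟨l, hl⟩ := d1
  obtain ⟨l, rfl⟩ := proj_surjective K 1 l
  have hr1 : proj K 1 r = (X 0 - X 1) * proj K 1 l :=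
    mul_left_cancel₀ (X_ne_zero K 0) (by rw [e1, hl]; ring)
  rw [← dvd_sub_left (dvd_mul_right _ l)]
  apply params_zero_dvd_of_proj_one_eq_zero
  · rw [map_sub, map_mul, proj_params_zero, hr1]
    simp
  · rw [map_sub]
    refine (dvd_sub_left ?_).2 ?_
    · rw [map_mul, proj_params_zero]
      exact dvd_mul_right _ _
    · exact X_dvd_of_dvd_X_mul (t := 1) (by decide)
        ⟨proj K 0 r - proj K 0 v, by linear_combination -e0⟩
  · rw [map_sub]
    refine (dvd_sub_left ?_).2 ?_
    · rw [map_mul, proj_params_zero]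
      exact dvd_mul_of_dvd_left (dvd_neg.2 dvd_rfl) _
    · exact X_dvd_of_dvd_X_mul (t := 1) (by decide)
        ⟨proj K 2 v, by linear_combination -e2⟩

theorem isRegular_params :
    RingTheory.Sequence.IsRegular (PathRing K) [params K 0, params K 1] := by
  have hm : ∀ r ∈ [params K 0, params K 1], r ∈ IsLocalRing.maximalIdeal (PathRing K) := by
    simpa using ⟨params_mem K 0, params_mem K 1⟩
  refine RingTheory.Sequence.IsRegular.of_isWeaklyRegular_of_mem_maximalIdeal _ hm ?_
  rw [RingTheory.Sequence.isWeaklyRegular_cons_iff,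
    RingTheory.Sequence.isWeaklyRegular_singleton_iff]
  constructor
  · rw [isSMulRegular_iff_right_eq_zero_of_smul]
    exact fun r hr => params_zero_mul_eq_zero K hr
  · rw [isSMulRegular_iff_right_eq_zero_of_smul]
    intro r hr
    obtain ⟨r, rfl⟩ := Submodule.Quotient.mk_surjective _ r
    rw [← Submodule.Quotient.mk_smul, Submodule.Quotient.mk_eq_zero,
      Submodule.mem_smul_pointwise_iff_exists] at hr
    rw [Submodule.Quotient.mk_eq_zero, Submodule.mem_smul_pointwise_iff_exists]
    obtain ⟨v, -, hv⟩ := hr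
    obtain ⟨l, hl⟩ := params_zero_dvd_of_dvd_mul K (r := r) ⟨v, hv.symm⟩
    exact ⟨l, trivial, hl.symm⟩

theorem ringKrullDim_eq_two : ringKrullDim (PathRing K) = 2 := by
  have h := ringKrullDim_add_length_eq_ringKrullDim_of_isRegular _ (isRegular_params K)
  have hI : Ideal.ofList [params K 0, params K 1] = Ideal.span (Set.range (params K)) := by
    rw [Ideal.ofList]
    congr 1
    ext r
    simp [Fin.exists_fin_two, eq_comm]
  have hne : Ideal.span (Set.range (params K)) ≠ ⊤ := fun h => by
    have := radical_span_params K
    rw [h, Ideal.radical_top] at this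
    exact (IsLocalRing.maximalIdeal.isMaximal _).ne_top this.symm
  have h0 : ringKrullDim (PathRing K ⧸ Ideal.span (Set.range (params K))) = 0 := by
    have := Ideal.Quotient.nontrivial_iff.2 hne
    rw [← ringKrullDimZero_iff_ringKrullDim_eq_zero,
      Ideal.krullDimLE_zero_quotient_iff_forall_minimalPrimes_isMaximal]
    intro P hP
    have hle : IsLocalRing.maximalIdeal (PathRing K) ≤ P := by
      rw [← radical_span_params, hP.1.1.radical_le_iff]
      exact hP.1.2
    rw [← (IsLocalRing.maximalIdeal.isMaximal _).eq_of_le hP.1.1.ne_top hle]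
    infer_instance
  rw [hI, h0] at h
  rw [← h]
  rfl

theorem isCohenMacaulayLocal : IsCohenMacaulayLocal (PathRing K) :=
  ⟨inferInstance, [params K 0, params K 1], by
    simpa using ⟨params_mem K 0, params_mem K 1⟩, isRegular_params K, by
    rw [ringKrullDim_eq_two]; rfl⟩

theorem isSystemOfParameters_pow {n : ℕ} (hn : 0 < n) :
    IsSystemOfParameters (PathRing K) fun i => params K i ^ n := by
  refine ⟨by rw [ringKrullDim_eq_two]; rfl, le_antisymm ?_ ?_⟩
  · rw [Ideal.IsPrime.radical_le_iff inferInstance, Ideal.span_le]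
    rintro _ ⟨i, rfl⟩
    exact Ideal.pow_mem_of_mem _ (params_mem K i) n hn
  · rw [← radical_span_params, Ideal.radical_le_radical_iff, Ideal.span_le]
    rintro _ ⟨i, rfl⟩
    exact ⟨n, Ideal.subset_span ⟨i, rfl⟩⟩

theorem isSystemOfParameters_params : IsSystemOfParameters (PathRing K) (params K) := by
  simpa using isSystemOfParameters_pow K one_pos

end PathRing

/-! ### Functoriality of tight closure -/

section TightClosureLemmas

variable {R : Type u} [CommRing R] (p : ℕ) [Fact p.Prime] [CharP R p]

theorem frobTmul_eq_zero_of_mem_frobPower_bot {e : ℕ} {M : Type v} [AddCommGroup M] [Module R M]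
    {ξ : FrobFunctor R p e M} (h : ξ ∈ frobPower p e (⊥ : Submodule R M)) : ξ = 0 := by
  obtain ⟨ζ, rfl⟩ := h
  have : (⊥ : Submodule R M).subtype = 0 := by
    ext ⟨m, hm⟩
    simpa using hm
  rw [this, LinearMap.baseChange_zero, LinearMap.zero_apply]

theorem frobTmul_mem_frobPower {e : ℕ} {M : Type v} [AddCommGroup M] [Module R M]
    {N : Submodule R M} (c : R) {m : M} (hm : m ∈ N) :
    frobTmul R p e c m ∈ frobPower p e N :=
  ⟨FrobTwist.mk R p e c ⊗ₜ ⟨m, hm⟩, LinearMap.baseChange_tmul ..⟩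

theorem frobTmul_smul (e : ℕ) {M : Type v} [AddCommGroup M] [Module R M] (c r : R) (m : M) :
    frobTmul R p e c (r • m) = frobTmul R p e (r ^ p ^ e * c) m := by
  rw [frobTmul, TensorProduct.tmul_smul, TensorProduct.smul_tmul', Algebra.smul_def,
    FrobTwist.algebraMap_apply, ← map_mul]
  rfl

theorem frobTmul_add (e : ℕ) {M : Type v} [AddCommGroup M] [Module R M] (c : R) (m m' : M) :
    frobTmul R p e c (m + m') = frobTmul R p e c m + frobTmul R p e c m' :=
  TensorProduct.tmul_add ..

theorem map_mem_tightClosure_bot {M : Type v} [AddCommGroup M] [Module R M] {M' : Type v}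
    [AddCommGroup M'] [Module R M'] (φ : M →ₗ[R] M') {N : Submodule R M}
    (hN : N ≤ LinearMap.ker φ) {m : M} (hm : m ∈ tightClosure p N) :
    φ m ∈ tightClosure p (⊥ : Submodule R M') := by
  obtain ⟨c, hc, e₀, h⟩ := hm
  refine ⟨c, hc, e₀, fun e he => ?_⟩
  obtain ⟨ζ, hζ⟩ := h e he
  have hz : φ ∘ₗ N.subtype = 0 := by
    ext n
    exact hN n.2
  have h0 : frobTmul R p e c (φ m) = φ.baseChange (FrobTwist R p e) (frobTmul R p e c m) :=
    (LinearMap.baseChange_tmul ..).symm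
  rw [h0, ← hζ, ← LinearMap.comp_apply, ← LinearMap.baseChange_comp, hz,
    LinearMap.baseChange_zero, LinearMap.zero_apply]
  exact Submodule.zero_mem _

/-- The image of `I^*` in the finitely generated module `R / I` lies in the tight closure of zero.
-/
theorem testIdeal_le_parameterTestIdeal [IsLocalRing R] :
    testIdeal R p ≤ parameterTestIdeal R p := by
  intro r hr
  simp only [parameterTestIdeal, Submodule.mem_iInf]
  intro d f _
  simp only [testIdeal, Submodule.mem_iInf] at hr
  rw [Submodule.mem_colon]
  intro s hs
  have h1 := map_mem_tightClosure_bot p (Submodule.mkQ (Ideal.span (Set.range f)))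
    (Submodule.ker_mkQ _).ge hs
  have h2 := Module.mem_annihilator.1 (hr (R ⧸ Ideal.span (Set.range f)) _ _ inferInstance) ⟨_, h1⟩
  rw [Subtype.ext_iff] at h2
  change r • (Submodule.mkQ (Ideal.span (Set.range f))) s = 0 at h2
  rwa [← map_smul, Submodule.mkQ_apply, Submodule.Quotient.mk_eq_zero] at h2

end TightClosureLemmas

/-! ### Tight closure of zero in modules, by duality with power series -/

namespace MvPowerSeries

instance charP {σ K : Type*} [CommRing K] (p : ℕ) [CharP K p] : CharP (MvPowerSeries σ K) p :=
  charP_of_injective_ringHom C_injective p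

variable {σ : Type*} {K : Type*} [Field K] {R : Type u} [CommRing R] [Algebra K R]
  (π : R →ₐ[K] MvPowerSeries σ K)

theorem comap_powSpan_le [IsLocalRing R] (hπ : Function.Surjective π) (n : ℕ) :
    (powSpan σ K n).comap π ≤ RingHom.ker π ⊔ IsLocalRing.maximalIdeal R ^ n := by
  intro r hr
  choose t ht using fun s : σ => hπ (X s)
  have htm : ∀ s, t s ∈ IsLocalRing.maximalIdeal R := fun s => by
    rw [IsLocalRing.mem_maximalIdeal, mem_nonunits_iff]
    intro hu
    have := hu.map π
    rw [ht, isUnit_iff_constantCoeff, constantCoeff_X] at this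
    exact not_isUnit_zero this
  have hmap : powSpan σ K n = (Ideal.span (Set.range fun s => t s ^ n)).map π := by
    rw [powSpan, Ideal.map_span, ← Set.range_comp]
    congr 2
    ext1 s
    simp [ht]
  rw [Ideal.mem_comap, hmap, Ideal.mem_map_iff_of_surjective π hπ] at hr
  obtain ⟨r', hr', he⟩ := hr
  rw [← sub_add_cancel r r']
  refine Submodule.add_mem_sup ?_ ?_
  · rw [RingHom.mem_ker, map_sub, he, sub_self]
  · refine (Ideal.span_le.2 ?_ : Ideal.span _ ≤ _) hr'
    rintro _ ⟨s, rfl⟩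
    exact Ideal.pow_mem_pow (htm s) n

section DualMap

variable [Finite σ] (hπ : Function.Surjective π) {M : Type v} [AddCommGroup M] [Module R M]
  [Module K M] (n : ℕ) (l : M →ₗ[K] K)

open Classical in
/-- The coefficients of `dualMap`. -/
noncomputable def dualCoeff (k : σ →₀ ℕ) (m : M) : K :=
  if k ≤ socleExp σ n then
    l (Function.surjInv hπ (monomial (socleExp σ n - k) 1) • m) else 0

/-- The map `M → K⟦σ⟧` that corresponds to a `K`-linear form `l` on `M` under the duality between
linear forms and homomorphisms to `K⟦σ⟧ / (X_s ^ n)`. -/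
noncomputable def dualMap : M →+ MvPowerSeries σ K :=
  AddMonoidHom.mk' (fun m k => dualCoeff π hπ n l k m) fun m m' => by
    funext k
    change dualCoeff π hπ n l k (m + m') = dualCoeff π hπ n l k m + dualCoeff π hπ n l k m'
    simp only [dualCoeff]
    split_ifs <;> simp

theorem coeff_dualMap {k : σ →₀ ℕ} (hk : k ≤ socleExp σ n) (m : M) :
    coeff k (dualMap π hπ n l m) =
      l (Function.surjInv hπ (monomial (socleExp σ n - k) 1) • m) :=
  if_pos hk

theorem le_socleExp {k : σ →₀ ℕ} (hk : ∀ s, k s < n) : k ≤ socleExp σ n := fun s => by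
  have := hk s
  rw [socleExp_apply]
  omega

variable {l n}

/-- With `N` the socle exponent, the coefficient of the dual map at `k` is `l` applied to a lift of
`X ^ (N - k)` times `m`. Linearity thus reduces to a congruence between elements of `R`, which holds
because `l` kills the preimage of `(X_s ^ n)` times `M`. -/
theorem dualMap_smul_sub_mem [IsScalarTower K R M]
    (hl : ∀ r, π r ∈ powSpan σ K n → ∀ m, l (r • m) = 0) (r : R) (m : M) :
    dualMap π hπ n l (r • m) - π r * dualMap π hπ n l m ∈ powSpan σ K n := by
  classical
  rw [mem_powSpan_iff]
  intro k hk
  by_contra! hkn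
  apply hk
  have hkN : k ≤ socleExp σ n := le_socleExp n hkn
  set N := socleExp σ n
  set T : (σ →₀ ℕ) → R := fun k => Function.surjInv hπ (monomial k 1)
  have hT : ∀ k, π (T k) = monomial k 1 := fun k => Function.surjInv_eq hπ _
  have hsum : coeff k (π r * dualMap π hπ n l m) =
      l ((∑ ij ∈ Finset.HasAntidiagonal.antidiagonal k, coeff ij.1 (π r) • T (N - ij.2)) • m) := by
    rw [coeff_mul, Finset.sum_smul, map_sum]
    refine Finset.sum_congr rfl fun ij hij => ?_
    have hij' : ij.1 + ij.2 = k := Finset.HasAntidiagonal.mem_antidiagonal.1 hij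
    rw [coeff_dualMap _ _ _ _ ((le_add_self.trans hij'.le).trans hkN), smul_assoc,
      LinearMap.map_smul, smul_eq_mul]
  rw [map_sub, hsum, coeff_dualMap _ _ _ _ hkN, ← mul_smul, ← map_sub, ← sub_smul]
  refine hl _ ?_ m
  rw [map_sub, map_mul, map_sum, mem_powSpan_iff]
  intro d hd
  by_contra! hdn
  apply hd
  have hdN : d ≤ N := le_socleExp n hdn
  rw [map_sub, sub_eq_zero, map_sum]
  change coeff d (π (T (N - k)) * π r) = _
  rw [hT, coeff_monomial_mul, one_mul]
  have hterm : ∀ ij : (σ →₀ ℕ) × (σ →₀ ℕ),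
      coeff d (π (coeff ij.1 (π r) • T (N - ij.2))) =
        if d = N - ij.2 then coeff ij.1 (π r) else 0 := fun ij => by
    rw [map_smul, hT, coeff_smul, coeff_monomial]
    split_ifs <;> simp
  simp only [hterm]
  split_ifs with hle
  -- In a pair `(i, j)` with `i + j = k`, the condition `d = N - j` forces `j = N - d` and `i = d -
  -- (N - k)`.
  · rw [Finset.sum_eq_single (d - (N - k), N - d)]
    · rw [if_pos (tsub_tsub_cancel_of_le hdN).symm]
    · rintro ⟨i, j⟩ hij hne
      rw [if_neg]
      rintro rfl
      have hij : i + j = k := Finset.HasAntidiagonal.mem_antidiagonal.1 hij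
      apply hne
      have hjN : j ≤ N := (le_add_self.trans hij.le).trans hkN
      rw [tsub_tsub_cancel_of_le hjN]
      congr 1
      ext s
      have h1 := DFunLike.congr_fun hij s
      have h2 := hkN s
      simp only [Finsupp.add_apply, Finsupp.tsub_apply] at h1 ⊢
      omega
    · intro h
      exfalso
      apply h
      rw [Finset.HasAntidiagonal.mem_antidiagonal]
      ext s
      have h1 := hdN s
      have h2 := hkN s
      have h3 := hle s
      simp only [Finsupp.add_apply, Finsupp.tsub_apply] at h3 ⊢
      omega
  · symm
    refine Finset.sum_eq_zero ?_
    rintro ⟨i, j⟩ hij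
    rw [if_neg]
    rintro rfl
    have hij : i + j = k := Finset.HasAntidiagonal.mem_antidiagonal.1 hij
    exact hle (tsub_le_tsub_left (le_add_self.trans hij.le) N)

/-- The coefficient at the socle exponent is `l m`, since the chosen lift of `1` differs from `1` by
an element of the kernel. -/
theorem dualMap_notMem [Nonempty σ]
    (hl : ∀ r, π r ∈ powSpan σ K n → ∀ m, l (r • m) = 0) {m : M} (hm : l m ≠ 0) :
    dualMap π hπ n l m ∉ powSpan σ K n := by
  intro h
  have hn : 0 < n := by
    rcases Nat.eq_zero_or_pos n with rfl | hn
    · refine absurd ?_ hm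
      rw [← one_smul R m]
      exact hl 1 (mem_powSpan_iff.2 fun k _ => ⟨Classical.arbitrary σ, Nat.zero_le _⟩) m
    · exact hn
  obtain ⟨s, hs⟩ := mem_powSpan_iff.1 h (socleExp σ n) (by
    rw [coeff_dualMap _ _ _ _ le_rfl, tsub_self]
    intro h0
    apply hm
    have := hl (Function.surjInv hπ (monomial 0 1) - 1) (by
      rw [map_sub, Function.surjInv_eq hπ, monomial_zero_one, map_one, sub_self]
      exact Ideal.zero_mem _) m
    rw [sub_smul, one_smul, map_sub, h0, zero_sub, neg_eq_zero] at this
    exact this)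
  rw [socleExp_apply] at hs
  omega

end DualMap

variable (p : ℕ) [Fact p.Prime] [CharP K p] [CharP R p]

/-- The homomorphism `F^e(M) → K⟦σ⟧ / (X_s ^ (n p ^ e))`, `c ⊗ m ↦ c φ(m) ^ (p ^ e)`, where `φ` is
linear modulo `(X_s ^ n)`. -/
noncomputable def frobEval (e n : ℕ) {M : Type v} [AddCommGroup M] [Module R M]
    (φ : M →+ MvPowerSeries σ K) (hφ : ∀ r m, φ (r • m) - π r * φ m ∈ powSpan σ K n) :
    FrobFunctor R p e M →+ MvPowerSeries σ K ⧸ powSpan σ K (n * p ^ e) :=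
  let q := Ideal.Quotient.mk (powSpan σ K (n * p ^ e))
  let f : FrobTwist R p e →+ MvPowerSeries σ K ⧸ powSpan σ K (n * p ^ e) :=
    ((q.comp π.toRingHom).comp (FrobTwist.mk R p e).symm.toRingHom).toAddMonoidHom
  let g : M →+ MvPowerSeries σ K ⧸ powSpan σ K (n * p ^ e) :=
    (q.comp (iterateFrobenius (MvPowerSeries σ K) p e)).toAddMonoidHom.comp φ
  TensorProduct.liftAddHom ((AddMonoidHom.mul.compl₂ g).comp f) (fun r c m => by
    obtain ⟨c, rfl⟩ := (FrobTwist.mk R p e).surjective c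
    rw [Algebra.smul_def, FrobTwist.algebraMap_apply, ← map_mul]
    change q (π (r ^ p ^ e * c)) * q (φ m ^ p ^ e) = q (π c) * q (φ (r • m) ^ p ^ e)
    rw [← map_mul, ← map_mul, eq_comm, Ideal.Quotient.eq]
    -- The tensor relation holds because a congruence modulo `(X_s ^ n)`, raised to the power `p ^
    -- e`, becomes one modulo `(X_s ^ (n p ^ e))`.
    have h := Ideal.mul_mem_left _ (π c) (pow_char_pow_mem_powSpan p e (hφ r m))
    rw [sub_pow_char_pow] at h
    convert h using 1
    rw [map_mul, map_pow]
    ring)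

theorem frobEval_frobTmul (e n : ℕ) {M : Type v} [AddCommGroup M] [Module R M]
    (φ : M →+ MvPowerSeries σ K) (hφ : ∀ r m, φ (r • m) - π r * φ m ∈ powSpan σ K n)
    (c : R) (m : M) :
    frobEval π p e n φ hφ (frobTmul R p e c m) =
      Ideal.Quotient.mk _ (π c * φ m ^ p ^ e) := by
  rw [map_mul]
  rfl

theorem exists_linearMap_of_notMem_smul_top {M : Type v} [AddCommGroup M] [Module R M]
    [Module K M] [IsScalarTower K R M] (J : Ideal R) {m : M}
    (hm : m ∉ J • (⊤ : Submodule R M)) :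
    ∃ l : M →ₗ[K] K, l m ≠ 0 ∧ ∀ r ∈ J, ∀ m', l (r • m') = 0 := by
  set N : Submodule K M := (J • (⊤ : Submodule R M)).restrictScalars K with hN
  have hmN : m ∉ N := by rwa [hN, Submodule.restrictScalars_mem]
  obtain ⟨l, hlm, hl⟩ := Submodule.exists_le_ker_of_notMem hmN
  refine ⟨l, hlm, fun r hr m' => ?_⟩
  have hr' : r • m' ∈ N := by
    rw [hN, Submodule.restrictScalars_mem]
    exact Submodule.smul_mem_smul hr trivial
  exact LinearMap.mem_ker.1 (hl hr')

variable [Finite σ]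

/-- Tight closure of zero is trivial modulo the ideals `(X_s ^ n)` of a power series ring. -/
theorem mem_comap_powSpan_smul_top [Nonempty σ] (hπ : Function.Surjective π)
    {M : Type v} [AddCommGroup M] [Module R M] {c : R} (hc : π c ≠ 0) {e₀ : ℕ} {m : M}
    (h : ∀ e ≥ e₀, frobTmul R p e c m = 0) (n : ℕ) :
    m ∈ (powSpan σ K n).comap π • (⊤ : Submodule R M) := by
  by_contra hm
  let _ : Module K M := Module.compHom M (algebraMap K R)
  have : IsScalarTower K R M := ⟨fun a r m => by
    rw [Algebra.smul_def, mul_smul]; rfl⟩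
  obtain ⟨l, hlm, hl⟩ := exists_linearMap_of_notMem_smul_top (K := K) _ hm
  refine dualMap_notMem π hπ hl hlm (mem_powSpan_of_mul_pow_mem p (e₀ := e₀) hc fun e he => ?_)
  have h1 := frobEval_frobTmul π p e n (dualMap π hπ n l) (dualMap_smul_sub_mem π hπ hl) c m
  rw [h e he, map_zero] at h1
  exact Ideal.Quotient.eq_zero_iff_mem.1 h1.symm

/-- If `R` surjects onto a power series ring with kernel `P`, then the tight closure of zero in a
finitely generated module `M` is contained in `P M`. -/
theorem mem_ker_smul_top_of_frobTmul_eq_zero [Nonempty σ] [IsLocalRing R] [IsNoetherianRing R]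
    (hπ : Function.Surjective π) {M : Type v} [AddCommGroup M] [Module R M] [Module.Finite R M]
    {c : R} (hc : π c ≠ 0) {e₀ : ℕ} {m : M} (h : ∀ e ≥ e₀, frobTmul R p e c m = 0) :
    m ∈ RingHom.ker π • (⊤ : Submodule R M) := by
  set N : Submodule R M := RingHom.ker π • ⊤
  -- Krull's intersection theorem in `M / PM`: it suffices to lie in `m ^ n (M / PM)` for all `n`.
  rw [← Submodule.Quotient.mk_eq_zero N, ← Submodule.mem_bot R,
    ← Ideal.iInf_pow_smul_eq_bot_of_isLocalRing (M := M ⧸ N) (IsLocalRing.maximalIdeal R)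
      (IsLocalRing.maximalIdeal.isMaximal R).ne_top, Submodule.mem_iInf]
  intro n
  have h1 := Submodule.smul_mono_left (comap_powSpan_le π hπ n)
    (mem_comap_powSpan_smul_top π p hπ hc h n)
  have h2 := Submodule.mem_map_of_mem (f := N.mkQ) h1
  rw [Submodule.sup_smul, Submodule.map_sup, Submodule.mkQ_map_self, bot_sup_eq,
    Submodule.map_smul''] at h2
  exact Submodule.smul_mono le_rfl le_top h2

end MvPowerSeries

/-! ### The test ideal and the parameter test ideal -/

namespace PathRing

open MvPowerSeries

variable (K : Type u) [Field K] (p : ℕ) [Fact p.Prime] [CharP K p]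

theorem comp_smul_eq_zero_of_mem {M : Type v} [AddCommGroup M] [Module (PathRing K) M]
    {j : Fin 3} {m : M} (h : m ∈ RingHom.ker (proj K j) • (⊤ : Submodule (PathRing K) M)) :
    comp K j • m = 0 := by
  refine Submodule.smul_induction_on h (fun r hr m _ => ?_) fun m m' h h' => ?_
  · rw [← mul_smul, comp_mul_eq_zero K (RingHom.mem_ker.1 hr)]
    exact zero_smul (PathRing K) m
  · rw [smul_add, h, h', add_zero]

theorem comp_mem_testIdeal (j : Fin 3) : comp K j ∈ testIdeal (PathRing K) p := by
  simp only [testIdeal, Submodule.mem_iInf]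
  intro M _ _ _
  rw [Module.mem_annihilator]
  rintro ⟨m, c, hc, e₀, h⟩
  rw [Subtype.ext_iff]
  change comp K j • m = 0
  exact comp_smul_eq_zero_of_mem K (mem_ker_smul_top_of_frobTmul_eq_zero (proj K j) p
    (proj_surjective K j) (proj_ne_zero_of_mem_offMinimalPrimes K hc j)
    fun e he => frobTmul_eq_zero_of_mem_frobPower_bot p (h e he))

variable {K} in
/-- Tight closure can be tested on the components. -/
theorem mem_tightClosure_of_forall_proj {I : Ideal (PathRing K)} {u : PathRing K}
    (h : ∀ j, ∃ i ∈ I, proj K j u = proj K j i) : u ∈ tightClosure p I := by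
  -- The multiplier is `z + xw + y`. For each summand `comp K j`, replace `u` by the element of `I`
  -- that agrees with it on component `j`.
  refine ⟨_, comp_sum_mem_offMinimalPrimes K, 0, fun e _ => ?_⟩
  have hsum : frobTmul (PathRing K) p e (∑ j, comp K j) u =
      ∑ j, frobTmul (PathRing K) p e (comp K j) u := by
    simp only [frobTmul, map_sum, TensorProduct.sum_tmul]
  rw [hsum]
  refine Submodule.sum_mem _ fun j _ => ?_
  obtain ⟨i, hi, hu⟩ := h j
  have h0 : frobTmul (PathRing K) p e (comp K j) (u - i) = 0 := by
    have hpow : (u - i) ^ p ^ e * comp K j = 0 := by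
      rw [mul_comm]
      refine comp_mul_eq_zero K ?_
      rw [map_pow, map_sub, hu, sub_self, zero_pow (pow_ne_zero _ (Fact.out : p.Prime).ne_zero)]
    rw [← mul_one (u - i), ← smul_eq_mul, frobTmul_smul, hpow, frobTmul, map_zero,
      TensorProduct.zero_tmul]
  rw [← sub_add_cancel u i, frobTmul_add, h0, zero_add]
  exact frobTmul_mem_frobPower p _ hi

variable {K} in
theorem mem_span_of_X_mul_X_dvd {r : PathRing K} (h : X 0 * X 1 ∣ proj K 1 r) :
    r ∈ Ideal.span {y K, z K, x K * w K} := by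
  obtain ⟨s, hs⟩ := h
  obtain ⟨s, rfl⟩ := proj_surjective K 1 s
  obtain ⟨α, β, hr⟩ := exists_eq_of_proj_one_eq_zero K (r := r - x K * w K * s) (by
    rw [map_sub, hs]
    simp)
  rw [sub_eq_iff_eq_add.1 hr]
  refine Ideal.add_mem _ (Ideal.add_mem _ ?_ ?_) ?_ <;>
    exact Ideal.mul_mem_right _ _ (Ideal.subset_span (by simp))

theorem params_zero_pow (e : ℕ) : params K 0 ^ p ^ e = x K ^ p ^ e - w K ^ p ^ e :=
  sub_pow_char_pow _ _ _

theorem params_one_pow (e : ℕ) :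
    params K 1 ^ p ^ e = x K ^ p ^ e - y K ^ p ^ e - z K ^ p ^ e := by
  rw [← sub_pow_char_pow, ← sub_pow_char_pow]
  rfl

theorem x_pow_mem_tightClosure (e : ℕ) :
    x K ^ p ^ e ∈ tightClosure p (Ideal.span (Set.range fun i => params K i ^ p ^ e)) := by
  have hq : p ^ e ≠ 0 := pow_ne_zero _ (Fact.out : p.Prime).ne_zero
  refine mem_tightClosure_of_forall_proj p fun j => ?_
  fin_cases j
  · refine ⟨params K 0 ^ p ^ e, Ideal.subset_span ⟨0, rfl⟩, ?_⟩
    simp [proj_params_zero]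
  · refine ⟨params K 1 ^ p ^ e, Ideal.subset_span ⟨1, rfl⟩, ?_⟩
    simp [proj_params_one]
  · exact ⟨0, Ideal.zero_mem _, by simp [zero_pow hq]⟩

-- Write `r x ^ q` as a combination of the parameter powers with coefficients `c 0`, `c 1`. On the
-- middle component `x ^ q ∣ c 0`, so below exponent `q` the pure powers in `r` are those in `c 1`.
-- By gluing these are read off on the outer components, where `c 1` is divisible by `x ^ q` and `w
-- ^ q` respectively.
variable {K} in
theorem coeff_proj_one_eq_zero_of_mul_x_pow_mem {e : ℕ} {r : PathRing K}
    (h : r * x K ^ p ^ e ∈ Ideal.span (Set.range fun i => params K i ^ p ^ e)) {n : ℕ}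
    (hn : n < p ^ e) :
    coeff (Finsupp.single 0 n) (proj K 1 r) = 0 ∧ coeff (Finsupp.single 1 n) (proj K 1 r) = 0 := by
  rw [Ideal.mem_span_range_iff_exists_fun] at h
  obtain ⟨c, hc⟩ := h
  rw [Fin.sum_univ_two, params_zero_pow, params_one_pow] at hc
  set q := p ^ e
  have hq : q ≠ 0 := pow_ne_zero _ (Fact.out : p.Prime).ne_zero
  have E : ∀ j, _ := fun j => congrArg (proj K j) hc
  simp only [map_mul, map_add, map_sub, map_pow, proj_x, proj_y, proj_z, proj_w] at E
  have e0 := E 0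
  have e1 := E 1
  have e2 := E 2
  simp only [Matrix.cons_val_zero, Matrix.cons_val_one, Matrix.cons_val, zero_pow hq, sub_zero,
    zero_sub, mul_zero] at e0 e1 e2
  have hX : (X 0 : MvPowerSeries (Fin 2) K) ^ q ≠ 0 := pow_ne_zero _ (X_ne_zero K 0)
  have d0 : X 0 ^ q ∣ proj K 0 (c 1) :=
    X_pow_dvd_of_dvd_X_pow_mul (t := 1) (k := q) (by decide)
      ⟨proj K 0 (c 0) + proj K 0 (c 1) - proj K 0 r, by linear_combination -e0⟩
  have d1 : X 0 ^ q ∣ proj K 1 (c 0) :=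
    X_pow_dvd_of_dvd_X_pow_mul (t := 1) (k := q) (by decide)
      ⟨proj K 1 (c 0) + proj K 1 (c 1) - proj K 1 r, by linear_combination -e1⟩
  have d2 : X 0 ^ q ∣ proj K 2 (c 1) :=
    X_pow_dvd_of_dvd_X_pow_mul (t := 1) (k := q) (by decide)
      ⟨-proj K 2 (c 0), by linear_combination -e2⟩
  obtain ⟨s, hs⟩ := d1
  have hr : proj K 1 r = X 0 ^ q * s + proj K 1 (c 1) - X 1 ^ q * s :=
    mul_right_cancel₀ hX (by rw [← e1, hs]; ring)
  constructor
  · rw [hr, map_sub, map_add, coeff_X_pow_mul_eq_zero (by simpa using hn),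
      coeff_X_pow_mul_eq_zero (by simpa using hq.bot_lt), ← coeff_proj_zero_eq,
      X_pow_dvd_iff.1 d0 _ (by simpa using hn)]
    simp
  · rw [hr, map_sub, map_add, coeff_X_pow_mul_eq_zero (by simpa using hq.bot_lt),
      coeff_X_pow_mul_eq_zero (by simpa using hn), coeff_proj_one_eq,
      X_pow_dvd_iff.1 d2 _ (by simpa using hn)]
    simp

theorem parameterTestIdeal_le :
    parameterTestIdeal (PathRing K) p ≤ Ideal.span {y K, z K, x K * w K} := by
  intro r hr
  have key : ∀ n, coeff (Finsupp.single 0 n) (proj K 1 r) = 0 ∧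
      coeff (Finsupp.single 1 n) (proj K 1 r) = 0 := fun n => by
    refine coeff_proj_one_eq_zero_of_mul_x_pow_mem p (e := n) ?_
      (Nat.lt_pow_self (Fact.out : p.Prime).one_lt)
    simp only [parameterTestIdeal, Submodule.mem_iInf] at hr
    exact Submodule.mem_colon.1
      (hr 2 _ (isSystemOfParameters_pow K (pow_pos (Fact.out : p.Prime).pos n))) _
      (x_pow_mem_tightClosure K p n)
  exact mem_span_of_X_mul_X_dvd
    (X_zero_mul_X_one_dvd (fun n => (key n).1) fun n => (key n).2)

theorem span_le_testIdeal : Ideal.span {y K, z K, x K * w K} ≤ testIdeal (PathRing K) p := by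
  rw [← span_comp, Ideal.span_le]
  rintro _ ⟨j, rfl⟩
  exact comp_mem_testIdeal K p j

theorem parameterTestIdeal_eq :
    parameterTestIdeal (PathRing K) p = Ideal.span {y K, z K, x K * w K} :=
  le_antisymm (parameterTestIdeal_le K p)
    ((span_le_testIdeal K p).trans (testIdeal_le_parameterTestIdeal p))

theorem testIdeal_eq : testIdeal (PathRing K) p = Ideal.span {y K, z K, x K * w K} :=
  le_antisymm ((testIdeal_le_parameterTestIdeal p).trans (parameterTestIdeal_le K p))
    (span_le_testIdeal K p)

end PathRing

/-! ### Top local cohomology and iterated Frobenius -/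

section TopLocalCohomologyLemmas

variable {R : Type u} [CommRing R] {d : ℕ} (x : Fin d → R)

instance powTransition_directedSystem :
    DirectedSystem (fun t => R ⧸ powIdeal x t) fun s t h => powTransition x s t h where
  map_self t r := by
    obtain ⟨r, rfl⟩ := Ideal.Quotient.mk_surjective r
    change Ideal.Quotient.mk (powIdeal x t) ((∏ i, x i) ^ (t - t) * r) = _
    rw [Nat.sub_self, pow_zero, one_mul]
  map_map s t k hkt hts r := by
    obtain ⟨r, rfl⟩ := Ideal.Quotient.mk_surjective r
    change Ideal.Quotient.mk (powIdeal x s) ((∏ i, x i) ^ (s - t) * ((∏ i, x i) ^ (t - k) * r)) =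
      Ideal.Quotient.mk (powIdeal x s) ((∏ i, x i) ^ (s - k) * r)
    rw [← mul_assoc, ← pow_add, tsub_add_tsub_cancel hts hkt]

variable {x} in
theorem exists_mem_powIdeal_of_topClass_eq_zero {t : ℕ} {r : R} (h : topClass x t r = 0) :
    ∃ s, t ≤ s ∧ ∀ s' ≥ s, (∏ i, x i) ^ (s' - t) * r ∈ powIdeal x s' := by
  obtain ⟨s, hts, hs⟩ := Module.DirectLimit.of.zero_exact h
  refine ⟨s, hts, fun s' hs' => ?_⟩
  have h1 : powTransition x t s' (hts.trans hs') (Ideal.Quotient.mk _ r) = 0 := by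
    rw [← (powTransition_directedSystem x).map_map hts hs', hs, map_zero]
  exact Ideal.Quotient.eq_zero_iff_mem.1 h1

variable (p : ℕ) [Fact p.Prime] [CharP R p]

theorem topFrobenius_iterate_topClass (e t : ℕ) (r : R) :
    (topFrobenius x p)^[e] (topClass x t r) = topClass x (t * p ^ e) (r ^ p ^ e) := by
  induction e with
  | zero => simp
  | succ e ih =>
    rw [Function.iterate_succ_apply', ih, topFrobenius_topClass, ← pow_mul, mul_assoc, ← pow_succ]

theorem topFrobenius_iterate_smul (e : ℕ) (a : R) (h : TopLocalCohomology x) :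
    (topFrobenius x p)^[e] (a • h) = a ^ p ^ e • (topFrobenius x p)^[e] h := by
  obtain ⟨t, r, rfl⟩ := exists_topClass x h
  rw [← topClass_smul, topFrobenius_iterate_topClass, topFrobenius_iterate_topClass, mul_pow,
    topClass_smul]

/-- The map `F^e(H) → H`, `c ⊗ h ↦ c F^e(h)`, for the top local cohomology module `H`. -/
noncomputable def topFrobEval (e : ℕ) :
    FrobFunctor R p e (TopLocalCohomology x) →+ TopLocalCohomology x :=
  TensorProduct.liftAddHom
    (AddMonoidHom.mk' (fun c => AddMonoidHom.mk'
        (fun h => (FrobTwist.mk R p e).symm c • (topFrobenius x p)^[e] h)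
        fun h h' => by rw [iterate_map_add, smul_add])
      fun c c' => by
        ext h
        simp only [AddMonoidHom.mk'_apply, map_add, add_smul, AddMonoidHom.add_apply])
    (fun r c h => by
      obtain ⟨c, rfl⟩ := (FrobTwist.mk R p e).surjective c
      rw [Algebra.smul_def, FrobTwist.algebraMap_apply, ← map_mul]
      simp only [AddMonoidHom.mk'_apply, RingEquiv.symm_apply_apply]
      rw [topFrobenius_iterate_smul, mul_comm, mul_smul])

theorem topFrobEval_frobTmul (e : ℕ) (c : R) (h : TopLocalCohomology x) :
    topFrobEval x p e (frobTmul R p e c h) = c • (topFrobenius x p)^[e] h := rfl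

theorem mem_annTop_span_iff {A : Set R} {h : TopLocalCohomology x} :
    h ∈ annTop x (Ideal.span A) ↔ ∀ a ∈ A, a • h = 0 := by
  refine ⟨fun hh a ha => hh a (Ideal.subset_span ha), fun hh => ?_⟩
  have : Ideal.span A ≤ LinearMap.ker (LinearMap.toSpanSingleton R _ h) := Ideal.span_le.2 hh
  exact fun a ha => this ha

end TopLocalCohomologyLemmas

/-! ### The annihilator `N`, the class `η` and its Frobenius image -/

namespace PathRing

open MvPowerSeries

variable (K : Type u) [Field K] (p : ℕ) [Fact p.Prime] [CharP K p]

theorem proj_params_zero_pow (j : Fin 3) (e : ℕ) : proj K j (params K 0 ^ p ^ e) =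
    ![X 0 ^ p ^ e, X 0 ^ p ^ e - X 1 ^ p ^ e, -X 0 ^ p ^ e] j := by
  have hq : p ^ e ≠ 0 := pow_ne_zero _ (Fact.out : p.Prime).ne_zero
  rw [params_zero_pow]
  fin_cases j <;> simp [zero_pow hq]

theorem proj_params_one_pow (j : Fin 3) (e : ℕ) : proj K j (params K 1 ^ p ^ e) =
    ![X 0 ^ p ^ e - X 1 ^ p ^ e, X 0 ^ p ^ e, -X 1 ^ p ^ e] j := by
  have hq : p ^ e ≠ 0 := pow_ne_zero _ (Fact.out : p.Prime).ne_zero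
  rw [params_one_pow]
  fin_cases j <;> simp [zero_pow hq]

/-- At exponents `p ^ e` the powers of the parameters are differences of powers of variables, so
they generate the same ideal on each component. -/
theorem map_proj_powIdeal (j : Fin 3) (e : ℕ) :
    (powIdeal (params K) (p ^ e)).map (proj K j) = powSpan (Fin 2) K (p ^ e) := by
  have hm : ∀ i : Fin 2, X i ^ p ^ e ∈ powSpan (Fin 2) K (p ^ e) :=
    X_pow_mem_powSpan le_rfl
  have h0 : proj K j (params K 0 ^ p ^ e) ∈ (powIdeal (params K) (p ^ e)).map (proj K j) :=
    Ideal.mem_map_of_mem _ (Ideal.subset_span ⟨0, rfl⟩)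
  have h1 : proj K j (params K 1 ^ p ^ e) ∈ (powIdeal (params K) (p ^ e)).map (proj K j) :=
    Ideal.mem_map_of_mem _ (Ideal.subset_span ⟨1, rfl⟩)
  rw [proj_params_zero_pow] at h0
  rw [proj_params_one_pow] at h1
  apply le_antisymm
  · rw [powIdeal, Ideal.map_span, Ideal.span_le]
    rintro _ ⟨_, ⟨i, rfl⟩, rfl⟩
    fin_cases i
    · change proj K j (params K 0 ^ p ^ e) ∈ powSpan (Fin 2) K (p ^ e)
      rw [proj_params_zero_pow]
      fin_cases j
      · exact hm 0
      · exact sub_mem (hm 0) (hm 1)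
      · exact neg_mem (hm 0)
    · change proj K j (params K 1 ^ p ^ e) ∈ powSpan (Fin 2) K (p ^ e)
      rw [proj_params_one_pow]
      fin_cases j
      · exact sub_mem (hm 0) (hm 1)
      · exact hm 0
      · exact neg_mem (hm 1)
  · rw [powSpan, Ideal.span_le]
    rintro _ ⟨i, rfl⟩
    revert h0 h1
    fin_cases j <;> fin_cases i <;> intro h0 h1
    · exact h0
    · simpa using sub_mem h0 h1
    · exact h1
    · simpa using sub_mem h1 h0
    · simpa using neg_mem h0
    · simpa using neg_mem h1

theorem X_mul_X_pow (m Q : ℕ) : (X 0 * X 1 : MvPowerSeries (Fin 2) K) ^ (Q * (m - 1)) =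
    monomial (Q • socleExp (Fin 2) m) 1 := by
  rw [X_def, X_def, monomial_mul_monomial, monomial_pow, one_mul, one_pow]
  congr 2
  ext i
  fin_cases i <;> simp [mul_comm]

/-- Modulo `(X_s ^ (Q m))`, the element `∏ params` acts on the components like `± X_0 X_1`. -/
theorem proj_prod_params_pow (j : Fin 3) (e m : ℕ) (hm : 0 < m) :
    ∃ ε : MvPowerSeries (Fin 2) K, ε * ε = 1 ∧
      proj K j ((∏ i, params K i) ^ (p ^ e * (m - 1))) -
        ε * (X 0 * X 1) ^ (p ^ e * (m - 1)) ∈ powSpan (Fin 2) K (m * p ^ e) := by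
  set Q := p ^ e with hQ
  rw [Fin.prod_univ_two, pow_mul, pow_mul, mul_pow, mul_pow (X 0), map_pow, map_mul,
    hQ, proj_params_zero_pow, proj_params_one_pow, ← hQ]
  set A : MvPowerSeries (Fin 2) K := X 0 ^ Q with hA
  set B : MvPowerSeries (Fin 2) K := X 1 ^ Q
  have key : (A * (A - B)) ^ (m - 1) - (-1) ^ (m - 1) * (A * B) ^ (m - 1) ∈
      powSpan (Fin 2) K (m * Q) := by
    -- The difference of `A - B` and `-B` is `A`, so the error is a multiple of `A ^ (m - 1) * A = A
    -- ^ m`.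
    obtain ⟨h, hh⟩ := sub_dvd_pow_sub_pow (A - B) (-B) (m - 1)
    have hA' : A ^ m ∈ powSpan (Fin 2) K (m * Q) := by
      rw [hA, ← pow_mul]
      exact X_pow_mem_powSpan (mul_comm m Q).le 0
    convert Ideal.mul_mem_left _ h hA' using 1
    obtain ⟨m, rfl⟩ := Nat.exists_eq_succ_of_ne_zero hm.ne'
    rw [Nat.succ_sub_one] at hh ⊢
    rw [neg_pow B] at hh
    rw [mul_pow, mul_pow, pow_succ]
    linear_combination A ^ m * hh
  have hsq : ((-1 : MvPowerSeries (Fin 2) K) ^ (m - 1)) * (-1) ^ (m - 1) = 1 := by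
    rw [← mul_pow]; simp
  fin_cases j
  · exact ⟨_, hsq, key⟩
  · refine ⟨_, hsq, ?_⟩
    change ((A - B) * A) ^ (m - 1) - _ ∈ _
    rw [mul_comm (A - B)]
    exact key
  · refine ⟨1, one_mul 1, ?_⟩
    change ((-A) * (-B)) ^ (m - 1) - _ ∈ _
    rw [neg_mul_neg, one_mul, sub_self]
    exact Ideal.zero_mem _

-- The class dies at some level, which may be taken to be `p ^ (k + s)`. There the transition factor
-- acts on the component as a monomial up to sign, and the monomial can be cancelled.
variable {K} in
theorem proj_mem_powSpan_of_topClass_eq_zero (j : Fin 3) {k : ℕ} {r : PathRing K}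
    (h : topClass (params K) (p ^ k) r = 0) : proj K j r ∈ powSpan (Fin 2) K (p ^ k) := by
  obtain ⟨s, -, hs⟩ := exists_mem_powIdeal_of_topClass_eq_zero h
  have hp := (Fact.out : p.Prime)
  have hsk : s ≤ p ^ (k + s) :=
    (Nat.lt_pow_self hp.one_lt).le.trans (Nat.pow_le_pow_right hp.pos (Nat.le_add_left _ _))
  have h1 := Ideal.mem_map_of_mem (proj K j) (hs _ hsk)
  have hm : 0 < p ^ s := pow_pos hp.pos s
  have he : p ^ (k + s) - p ^ k = p ^ k * (p ^ s - 1) := by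
    rw [pow_add, Nat.mul_sub, mul_one]
  obtain ⟨ε, hε, h2⟩ := proj_prod_params_pow K p j k (p ^ s) hm
  rw [map_proj_powIdeal, he, map_mul, pow_add, mul_comm (p ^ k) (p ^ s)] at h1
  rw [X_mul_X_pow] at h2
  refine monomial_socleExp_mul_mem_powSpan hm ?_
  convert Ideal.mul_mem_left _ ε (sub_mem h1 (Ideal.mul_mem_left _ (proj K j r) h2)) using 1
  linear_combination (-proj K j r * monomial (p ^ k • socleExp (Fin 2) (p ^ s)) 1) * hε

-- The local cohomology module is not finitely generated, so the Frobenius action replaces the bound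
-- for finitely generated modules: it turns the tight closure condition into `c F^e(h) = 0`, and
-- `(X_s ^ (p ^ k))` is tightly closed on the component.
variable {K} in
theorem proj_mem_powSpan_of_mem_tightClosure (j : Fin 3) {k : ℕ} {r : PathRing K}
    (h : topClass (params K) (p ^ k) r ∈
      tightClosure p (⊥ : Submodule (PathRing K) (TopLocalCohomology (params K)))) :
    proj K j r ∈ powSpan (Fin 2) K (p ^ k) := by
  obtain ⟨c, hc, e₀, h⟩ := h
  refine mem_powSpan_of_mul_pow_mem p (proj_ne_zero_of_mem_offMinimalPrimes K hc j)
    (e₀ := e₀) fun e he => ?_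
  have h1 := topFrobEval_frobTmul (params K) p e c (topClass (params K) (p ^ k) r)
  rw [frobTmul_eq_zero_of_mem_frobPower_bot p (h e he), map_zero, topFrobenius_iterate_topClass,
    ← topClass_smul, ← pow_add] at h1
  have h2 := proj_mem_powSpan_of_topClass_eq_zero p j h1.symm
  rwa [map_mul, map_pow, pow_add] at h2

-- On component `j`, `r` agrees with an element of `I_q`, `q = p ^ k`, and multiplication by `comp K
-- j` forgets the other components.
variable {K} in
theorem comp_smul_topClass_eq_zero {j : Fin 3} {k : ℕ} {r : PathRing K}
    (h : proj K j r ∈ powSpan (Fin 2) K (p ^ k)) :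
    comp K j • topClass (params K) (p ^ k) r = 0 := by
  rw [← map_proj_powIdeal, Ideal.mem_map_iff_of_surjective _ (proj_surjective K j)] at h
  obtain ⟨i, hi, hir⟩ := h
  have : comp K j * r = comp K j * i := by
    rw [← sub_eq_zero, ← mul_sub]
    exact comp_mul_eq_zero K (by rw [map_sub, hir, sub_self])
  rw [← topClass_smul, this]
  exact topClass_eq_zero _ _ (Ideal.mul_mem_left _ _ hi)

theorem mem_annTop_parameterTestIdeal_iff {h : TopLocalCohomology (params K)} :
    h ∈ annTop (params K) (parameterTestIdeal (PathRing K) p) ↔ ∀ j, comp K j • h = 0 := by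
  rw [parameterTestIdeal_eq, ← span_comp, mem_annTop_span_iff, Set.forall_mem_range]

theorem tightClosure_bot_le_annTop :
    tightClosure p (⊥ : Submodule (PathRing K) (TopLocalCohomology (params K))) ≤
      annTop (params K) (parameterTestIdeal (PathRing K) p) := by
  intro h hh
  rw [mem_annTop_parameterTestIdeal_iff]
  intro j
  obtain ⟨t, r, rfl⟩ := exists_topClass _ h
  rw [← topClass_transition (params K) t (p ^ t)
    (Nat.lt_pow_self (Fact.out : p.Prime).one_lt).le] at hh ⊢
  exact comp_smul_topClass_eq_zero p (proj_mem_powSpan_of_mem_tightClosure p j hh)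

theorem X_mul_X_pow_notMem_powSpan {n N : ℕ} (h : n < N) :
    (X 0 * X 1 : MvPowerSeries (Fin 2) K) ^ n ∉ powSpan (Fin 2) K N := by
  intro hm
  have he := X_mul_X_pow K (n + 1) 1
  rw [one_mul, one_smul, Nat.add_sub_cancel] at he
  rw [he] at hm
  obtain ⟨s, hs⟩ := mem_powSpan_iff.1 hm (socleExp (Fin 2) (n + 1)) (by
    rw [coeff_monomial_same]; exact one_ne_zero)
  rw [socleExp_apply] at hs
  omega

theorem x_mul_w_pow_mem_powIdeal : (x K * w K) ^ p ∈ powIdeal (params K) p := by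
  have hp := (Fact.out : p.Prime).ne_zero
  have h0 : params K 0 ^ p ∈ powIdeal (params K) p := Ideal.subset_span ⟨0, rfl⟩
  have h1 : params K 1 ^ p ∈ powIdeal (params K) p := Ideal.subset_span ⟨1, rfl⟩
  have e0 := params_zero_pow K p 1
  have e1 := params_one_pow K p 1
  rw [pow_one] at e0 e1
  have hxy : x K ^ p * y K ^ p = 0 := by rw [← mul_pow, x_mul_y, zero_pow hp]
  have hzw : z K ^ p * w K ^ p = 0 := by rw [← mul_pow, z_mul_w, zero_pow hp]
  -- Modulo the relations, `(xw) ^ p = w ^ p (x ^ p - y ^ p - z ^ p) - y ^ p (x ^ p - w ^ p)`.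
  convert sub_mem (Ideal.mul_mem_left _ (w K ^ p) h1) (Ideal.mul_mem_left _ (y K ^ p) h0) using 1
  rw [e0, e1, mul_pow]
  linear_combination hxy + hzw

theorem topClass_mem_annTop :
    topClass (params K) p ((x K * w K) ^ (p - 1)) ∈
      annTop (params K) (parameterTestIdeal (PathRing K) p) := by
  have hp := (Fact.out : p.Prime)
  have hp1 : p - 1 ≠ 0 := by have := hp.two_le; omega
  rw [mem_annTop_parameterTestIdeal_iff]
  intro j
  by_cases hj : j = 1
  · subst hj
    change (x K * w K) • _ = (0 : TopLocalCohomology (params K))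
    rw [← topClass_smul, mul_pow_sub_one hp.ne_zero]
    exact topClass_eq_zero _ _ (x_mul_w_pow_mem_powIdeal K p)
  · have h0 : proj K j ((x K * w K) ^ (p - 1)) = 0 := by
      fin_cases j
      · simp [hp1]
      · exact absurd rfl hj
      · simp [hp1]
    have := comp_smul_topClass_eq_zero p (j := j) (k := 1)
      (r := (x K * w K) ^ (p - 1)) (by rw [h0]; exact Ideal.zero_mem _)
    rwa [pow_one] at this

theorem topFrobenius_topClass_notMem_annTop :
    topFrobenius (params K) p (topClass (params K) p ((x K * w K) ^ (p - 1))) ∉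
      annTop (params K) (parameterTestIdeal (PathRing K) p) := by
  have hp := (Fact.out : p.Prime)
  rw [mem_annTop_parameterTestIdeal_iff]
  intro h
  have h1 : (x K * w K) • _ = (0 : TopLocalCohomology (params K)) := h 1
  rw [topFrobenius_topClass, ← topClass_smul, ← pow_mul, ← pow_succ', ← sq] at h1
  have h2 := proj_mem_powSpan_of_topClass_eq_zero p 1 h1
  rw [map_pow, map_mul, proj_x, proj_w] at h2
  -- The exponent is `(p - 1) p + 1`, which is below `p ^ 2` because `p ≥ 2`.
  refine X_mul_X_pow_notMem_powSpan K ?_ h2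
  obtain ⟨q, rfl⟩ : ∃ q, p = q + 2 := ⟨p - 2, by have := hp.two_le; omega⟩
  rw [show q + 2 - 1 = q + 1 by omega]
  nlinarith

theorem topClass_notMem_tightClosure :
    topClass (params K) p ((x K * w K) ^ (p - 1)) ∉
      tightClosure p (⊥ : Submodule (PathRing K) (TopLocalCohomology (params K))) := by
  intro h
  have hp := (Fact.out : p.Prime)
  have h2 := proj_mem_powSpan_of_mem_tightClosure p (k := 1) 1 (by rwa [pow_one])
  rw [map_pow, map_mul, proj_x, proj_w, pow_one] at h2
  exact X_mul_X_pow_notMem_powSpan K (Nat.sub_lt hp.pos one_pos) h2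

theorem not_isFStable_annTop :
    ¬ IsFStable (params K) p (annTop (params K) (parameterTestIdeal (PathRing K) p)) := fun h =>
  topFrobenius_topClass_notMem_annTop K p (h _ (topClass_mem_annTop K p))

theorem tightClosure_bot_lt_annTop :
    tightClosure p (⊥ : Submodule (PathRing K) (TopLocalCohomology (params K))) <
      annTop (params K) (parameterTestIdeal (PathRing K) p) :=
  lt_of_le_of_ne (tightClosure_bot_le_annTop K p) fun h =>
    topClass_notMem_tightClosure K p (h ▸ topClass_mem_annTop K p)

end PathRing

theorem mainTheorem7 (K : Type u) [Field K] (p : ℕ) [Fact p.Prime] [CharP K p] :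
    -- `R` is a complete, reduced, Cohen–Macaulay local ring of dimension `2`,
    IsAdicComplete (IsLocalRing.maximalIdeal (PathRing K)) (PathRing K) ∧
    IsReduced (PathRing K) ∧
    IsCohenMacaulayLocal (PathRing K) ∧
    ringKrullDim (PathRing K) = 2 ∧
    -- with system of parameters `x - w, x - y - z`;
    IsSystemOfParameters (PathRing K) (PathRing.params K) ∧
    -- its parameter test ideal and its test ideal are `(y, z, xw)`;
    parameterTestIdeal (PathRing K) p =
      Ideal.span {PathRing.y K, PathRing.z K, PathRing.x K * PathRing.w K} ∧
    testIdeal (PathRing K) p =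
      Ideal.span {PathRing.y K, PathRing.z K, PathRing.x K * PathRing.w K} ∧
    -- `η = [(xw) ^ (p - 1) + (x ^ p - w ^ p, x ^ p - y ^ p - z ^ p)]` lies in `N`, but `F(η)` not;
    topClass (PathRing.params K) p ((PathRing.x K * PathRing.w K) ^ (p - 1)) ∈
      annTop (PathRing.params K) (parameterTestIdeal (PathRing K) p) ∧
    topFrobenius (PathRing.params K) p
        (topClass (PathRing.params K) p ((PathRing.x K * PathRing.w K) ^ (p - 1))) ∉
      annTop (PathRing.params K) (parameterTestIdeal (PathRing K) p) ∧
    -- so `N` is not `F`-stable, `N` contains `0^*` strictly, and `τ_par(R)` is not an `F`-ideal.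
    ¬ IsFStable (PathRing.params K) p
      (annTop (PathRing.params K) (parameterTestIdeal (PathRing K) p)) ∧
    tightClosure p (⊥ : Submodule (PathRing K) (TopLocalCohomology (PathRing.params K))) <
      annTop (PathRing.params K) (parameterTestIdeal (PathRing K) p) ∧
    ¬ IsFIdeal (PathRing.params K) p (parameterTestIdeal (PathRing K) p) := 
  ⟨PathRing.isAdicComplete K, inferInstance, PathRing.isCohenMacaulayLocal K,
    PathRing.ringKrullDim_eq_two K, PathRing.isSystemOfParameters_params K,
    PathRing.parameterTestIdeal_eq K p, PathRing.testIdeal_eq K p,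
    PathRing.topClass_mem_annTop K p, PathRing.topFrobenius_topClass_notMem_annTop K p,
    PathRing.not_isFStable_annTop K p, PathRing.tightClosure_bot_lt_annTop K p,
    PathRing.not_isFStable_annTop K p⟩
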